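/- Let $d\in\{2,3\}$, let $r\ge 0$ be an integer and let $\sigma>0$. There is a constant $\eta_0>0$, depending only on $d$, $r$ and $\sigma$, for which the following holds. **Mesh.** Let $\mathcal T_h$ be a finite conforming mesh of closed simplices of a bounded domain $\Omega\subset\mathbb R^d$: two elements meet in the (possibly empty) simplex spanned by their common vertices, and $\Omega$ is the interior of the union of the elements (as is the case for a meshed bounded Lipschitz domain; no further regularity of $\Omega$ is used). The mesh is shape-regular: $h_K\le\sigma\rho_K$ for each $K\in\mathcal T_h$, where $h_K$ is the diameter of $K$ and $\rho_K$ the diameter of the largest ball in $K$. Let $\mathcal F_h$ be the set of faces of $\mathcal T_h$; a face is an interior face if it is shared by two elements, and a boundary face if it lies in one element only. Let $h_F$ be the diameter of $F\in\mathcal F_h$. Each interior face has a fixed unit normal $n_F$, pointing from one adjacent element $K^+$ to the other one $K^-$; there $[\![\phi]\!]=\phi|_{K^+}-\phi|_{K^-}$ and $\{\!\{\phi\}\!\}=\frac12(\phi|_{K^+}+\phi|_{K^-})$. On a boundary face $n_F$ points outward and $[\![\phi]\!]=\{\!\{\phi\}\!\}=\phi|_K$. Put $[\![v\otimes n]\!]|_F=[\![v]\!]\otimes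 n_F$, let $n_K$ be the outward unit normal of $K$, let $(\cdot,\cdot)$ be the $L^2(\Omega)$ inner product and $\nabla_h$ the element-wise gradient, $(\nabla_h v)_{ij}=\partial_jv_i$. **Spaces and forms.** Let $V_h$ be a linear space of functions in $[L^2(\Omega)]^d$ whose restriction to each $K$ lies in $[\mathcal P_r(K)]^d$, and $Q_h$ a linear space of mean-value-zero functions in $L^2(\Omega)$ whose restriction to each $K$ lies in $\mathcal P_k(K)$, for some $k\ge0$ (this includes the $H^1$-conforming, $H(\mathrm{div})$-conforming and DG pairs). Let $\tau_h(v)$ be one of $\nabla_hv$, $\nabla_hv+\nabla_hv^T$, $\nabla_hv+\nabla_hv^T-\frac23(\nabla_h\cdot v)\mathbb I$, let $\nu>0$, and let $\eta_F,\zeta_F\ge0$ for $F\in\mathcal F_h$. Define \begin{align*} a_h(v,w)&=(\tau_h(v),\nabla_hw)-\sum_K\int_{\partial K}\big((\{\!\{\tau_h(v)\}\!\}-\eta_Fh_F^{-1}[\![v\otimes n]\!])\,n_K\big)\cdot w|_K\\ &\quad+\sum_K\int_{\partial K\setminus\partial\Omega}(\{\!\{v\}\!\}-v|_K)\cdot\tau_h(w)|_Kn_K-\int_{\partial\Omega}v\cdot\tau_h(w)n,\\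 b_h(v,q)&=(\nabla_h\cdot v,q)-\sum_{F\in\mathcal F_h}\int_F([\![v]\!]\cdot n_F)\{\!\{q\}\!\},\\ c_h(\beta;v,w)&=-(v\otimes\beta,\nabla_hw)-\tfrac12((\nabla_h\cdot\beta)v,w)+\sum_K\int_{\partial K}\big(\zeta_F\,|\{\!\{\beta\}\!\}\cdot n_F|\,[\![v\otimes n]\!]\,n_K\big)\cdot w|_K\\ &\quad+\sum_K\int_{\partial K}\big((\{\!\{v\}\!\}\otimes\{\!\{\beta\}\!\})n_K\big)\cdot w|_K+\tfrac12\sum_K\int_{\partial K\setminus\partial\Omega}\beta|_K\cdot n_K\,\{\!\{v\cdot w\}\!\}, \end{align*} let $d_h$ be a real-valued form on $V_h\times V_h$ and put $N_h(u;v)=c_h(u;u,v)+\nu a_h(u,v)+d_h(u,v)$. **Claim.** Assume $\eta_F\ge\eta_0$ for all $F\in\mathcal F_h$, $\zeta_F\ge\frac12$ on all boundary faces, and $d_h(v,v)\ge0$ for all $v\in V_h$. Let $T>0$ and $f\in L^1(0,T;[L^2(\Omega)]^d)$. Let $u_h(t)\in V_h$ ($0\le t\le T$) and $p_h(t)\in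 Q_h$ ($0<t\le T$) solve the semi-discrete scheme \begin{align*} (\partial_tu_h,v)+N_h(u_h;v)-b_h(v,p_h)&=(f,v)\quad\forall v\in V_h,\\ b_h(u_h,q)&=0\quad\forall q\in Q_h, \end{align*} either with $u_h$ continuous on $[0,T]$, differentiable on $(0,T]$, and the equations valid at every $t\in(0,T]$, or with $u_h$ absolutely continuous on $[0,T]$ and the equations valid at almost every $t$. Then for all $t\in[0,T]$ $$\|u_h(t)\|_{L^2(\Omega)}\le\|u_h(0)\|_{L^2(\Omega)}+\int_0^t\|f(s)\|_{L^2(\Omega)}\,ds .$$ -/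

import Mathlib

open MeasureTheory Set
open scoped Matrix

noncomputable section

namespace UnifiedNS

/-- Euclidean space `ℝ^d`. -/
abbrev E (d : ℕ) := EuclideanSpace ℝ (Fin d)

/-- The closed simplex spanned by a finite set of vertices. -/
def hull {d : ℕ} (K : Finset (E d)) : Set (E d) := convexHull ℝ (K : Set (E d))

open Classical in
/-- A conforming simplicial mesh of `Ω`.  An element is given by its `d + 1` affinely independent
vertices, a face by `d` of the vertices of an element, and two elements meet in the simplex spanned
by their common vertices.  `Ω` is the interior of the union of the closed elements.  The mesh comes
with an orientation of its faces: the elements that contain the face `F` are `plus F` and `minus F`.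
These two differ on an interior face, and coincide on a face that lies in a single element. -/
structure Mesh {d : ℕ} (Ω : Set (E d)) where
  elems : Finset (Finset (E d))
  card_eq : ∀ K ∈ elems, K.card = d + 1
  indep : ∀ K ∈ elems, AffineIndependent ℝ ((↑) : K → E d)
  conforming : ∀ K ∈ elems, ∀ L ∈ elems, hull K ∩ hull L = hull (K ∩ L)
  domain_eq : interior (⋃ K ∈ elems, hull K) = Ω
  plus : Finset (E d) → Finset (E d)
  minus : Finset (E d) → Finset (E d)
  adjacent : ∀ K ∈ elems, ∀ F ∈ K.powersetCard d,
    elems.filter (fun L => F ⊆ L) = {plus F, minus F}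

/-- The outward unit normal of the simplex `K` on its face `F`. -/
def outNormal {d : ℕ} (K F : Finset (E d)) : Fin d → ℝ :=
  (Classical.epsilon (fun n : E d => ‖n‖ = 1 ∧
    (∀ x ∈ F, ∀ y ∈ F, inner ℝ n (x - y) = 0) ∧
    (∀ x ∈ K, ∀ y ∈ F, inner ℝ n (x - y) ≤ 0))).ofLp

/-- Frobenius product of matrices. -/
def frob {d : ℕ} (A B : Matrix (Fin d) (Fin d) ℝ) : ℝ := ∑ i, ∑ j, A i j * B i j

namespace Mesh

variable {d : ℕ} {Ω : Set (E d)} (M : Mesh Ω)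

/-- `h_K ≤ σ ρ_K` for all elements, with `h_K` the diameter of `K` and `ρ_K` the diameter of the
largest ball contained in `K`. -/
def ShapeRegular (σ : ℝ) : Prop :=
  ∀ K ∈ M.elems, ∃ (c : E d) (ρ : ℝ), 0 < ρ ∧ Metric.closedBall c (ρ / 2) ⊆ hull K ∧
    Metric.diam (hull K) ≤ σ * ρ

open Classical in
/-- The collection of all faces. -/
def faces : Finset (Finset (E d)) := M.elems.biUnion (fun K => K.powersetCard d)

open Classical in
/-- The number of elements that contain `F`. -/
def numElems (F : Finset (E d)) : ℕ := (M.elems.filter (fun K => F ⊆ K)).card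

/-- An interior face is shared by two elements. -/
def IsInterior (F : Finset (E d)) : Prop := F ∈ M.faces ∧ M.numElems F = 2

/-- A boundary face is contained in a single element. -/
def IsBoundary (F : Finset (E d)) : Prop := F ∈ M.faces ∧ M.numElems F = 1

/-- The fixed unit normal of the face `F`: it points from `plus F` to `minus F` on interior faces,
and out of the domain on boundary faces. -/
def normal (F : Finset (E d)) : Fin d → ℝ := outNormal (M.plus F) F

section Traces

variable {α : Type} [AddCommGroup α] [Module ℝ α]

open Classical in
/-- The jump of an element-wise defined function across a face. -/
def jump (φ : Finset (E d) → E d → α) (F : Finset (E d)) (x : E d) : α :=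
  if M.IsInterior F then φ (M.plus F) x - φ (M.minus F) x else φ (M.plus F) x

open Classical in
/-- The average of an element-wise defined function on a face. -/
def avg (φ : Finset (E d) → E d → α) (F : Finset (E d)) (x : E d) : α :=
  if M.IsInterior F then (1 / 2 : ℝ) • (φ (M.plus F) x + φ (M.minus F) x) else φ (M.plus F) x

end Traces

/-- The jump `⟦v ⊗ n⟧` on a face. -/
def jumpTensor (v : Finset (E d) → E d → Fin d → ℝ) (F : Finset (E d)) (x : E d) :
    Matrix (Fin d) (Fin d) ℝ :=
  M.jump (fun K y => Matrix.vecMulVec (v K y) (M.normal F)) F x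

/-- Integral of `g` over a face with respect to the surface measure. -/
def _root_.UnifiedNS.surfInt {d : ℕ} (F : Finset (E d)) (g : E d → ℝ) : ℝ :=
  ∫ x in hull F, g x ∂(Measure.euclideanHausdorffMeasure (d - 1))

/-- `∑_K ∫_K g_K`. -/
def elemSum (g : Finset (E d) → E d → ℝ) : ℝ := ∑ K ∈ M.elems, ∫ x in hull K, g K x

/-- `∑_K ∫_{∂K} g_{K,F}`. -/
def bdrySum (g : Finset (E d) → Finset (E d) → E d → ℝ) : ℝ :=
  ∑ K ∈ M.elems, ∑ F ∈ K.powersetCard d, surfInt F (g K F)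

open Classical in
/-- `∑_K ∫_{∂K \ ∂Ω} g_{K,F}`. -/
def intBdrySum (g : Finset (E d) → Finset (E d) → E d → ℝ) : ℝ :=
  ∑ K ∈ M.elems, ∑ F ∈ (K.powersetCard d).filter (fun F => M.IsInterior F), surfInt F (g K F)

open Classical in
/-- `∫_{∂Ω} g`, where each boundary face is seen from the element that contains it. -/
def outerBdrySum (g : Finset (E d) → Finset (E d) → E d → ℝ) : ℝ :=
  ∑ K ∈ M.elems, ∑ F ∈ (K.powersetCard d).filter (fun F => M.IsBoundary F), surfInt F (g K F)

/-- `∑_F ∫_F g_F` over all faces. -/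
def faceSum (g : Finset (E d) → E d → ℝ) : ℝ := ∑ F ∈ M.faces, surfInt F (g F)

end Mesh

/-! ### Piecewise polynomial fields -/

/-- A vector polynomial on every element. -/
abbrev VecField (d : ℕ) := Finset (E d) → Fin d → MvPolynomial (Fin d) ℝ

/-- A scalar polynomial on every element. -/
abbrev ScalField (d : ℕ) := Finset (E d) → MvPolynomial (Fin d) ℝ

/-- Values of a scalar field, element by element. -/
def ScalField.val {d : ℕ} (q : ScalField d) (K : Finset (E d)) (x : E d) : ℝ :=
  MvPolynomial.eval x.ofLp (q K)

/-- Values of a vector field, element by element. -/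
def VecField.val {d : ℕ} (v : VecField d) (K : Finset (E d)) (x : E d) : Fin d → ℝ :=
  fun i => MvPolynomial.eval x.ofLp (v K i)

/-- The broken gradient, `(∇ v)_{ij} = ∂_j v_i`. -/
def VecField.grad {d : ℕ} (v : VecField d) (K : Finset (E d)) (x : E d) :
    Matrix (Fin d) (Fin d) ℝ :=
  Matrix.of fun i j => MvPolynomial.eval x.ofLp (MvPolynomial.pderiv j (v K i))

/-- The broken divergence. -/
def VecField.div {d : ℕ} (v : VecField d) (K : Finset (E d)) (x : E d) : ℝ :=
  (v.grad K x).trace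

/-- The three viscous strain tensors. -/
inductive StressKind
  | gradient
  | symmetric
  | full

/-- The strain tensor as a function of the velocity gradient `G`. -/
def StressKind.apply {d : ℕ} (κ : StressKind) (G : Matrix (Fin d) (Fin d) ℝ) :
    Matrix (Fin d) (Fin d) ℝ :=
  match κ with
  | .gradient => G
  | .symmetric => G + Gᵀ
  | .full => G + Gᵀ - ((2 / 3 : ℝ) * G.trace) • (1 : Matrix (Fin d) (Fin d) ℝ)

/-- The discrete viscous strain tensor `τ_h(v)`. -/
def VecField.stress {d : ℕ} (κ : StressKind) (v : VecField d) (K : Finset (E d)) (x : E d) :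
    Matrix (Fin d) (Fin d) ℝ :=
  κ.apply (v.grad K x)

/-! ### The forms of the scheme -/

namespace Mesh

variable {d : ℕ} {Ω : Set (E d)} (M : Mesh Ω)

/-- The viscous form `a_h`. -/
def formA (κ : StressKind) (η : Finset (E d) → ℝ) (v w : VecField d) : ℝ :=
  M.elemSum (fun K x => frob (v.stress κ K x) (w.grad K x))
  - M.bdrySum (fun K F x =>
      ((M.avg (v.stress κ) F x - (η F * (Metric.diam (hull F))⁻¹) • M.jumpTensor v.val F x)
        *ᵥ outNormal K F) ⬝ᵥ w.val K x)
  + M.intBdrySum (fun K F x =>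
      (M.avg v.val F x - v.val K x) ⬝ᵥ (w.stress κ K x *ᵥ outNormal K F))
  - M.outerBdrySum (fun K F x => v.val K x ⬝ᵥ (w.stress κ K x *ᵥ outNormal K F))

/-- The divergence form `b_h`. -/
def formB (v : VecField d) (q : ScalField d) : ℝ :=
  M.elemSum (fun K x => v.div K x * q.val K x)
  - M.faceSum (fun F x => (M.jump v.val F x ⬝ᵥ M.normal F) * M.avg q.val F x)

/-- The convective form `c_h(β; v, w)`. -/
def formC (ζ : Finset (E d) → ℝ) (β v w : VecField d) : ℝ :=
  - M.elemSum (fun K x => frob (Matrix.vecMulVec (v.val K x) (β.val K x)) (w.grad K x))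
  - 1 / 2 * M.elemSum (fun K x => β.div K x * (v.val K x ⬝ᵥ w.val K x))
  + M.bdrySum (fun K F x =>
      (((ζ F * |M.avg β.val F x ⬝ᵥ M.normal F|) • M.jumpTensor v.val F x)
        *ᵥ outNormal K F) ⬝ᵥ w.val K x)
  + M.bdrySum (fun K F x =>
      (Matrix.vecMulVec (M.avg v.val F x) (M.avg β.val F x) *ᵥ outNormal K F) ⬝ᵥ w.val K x)
  + 1 / 2 * M.intBdrySum (fun K F x =>
      β.val K x ⬝ᵥ (M.avg (fun L y => v.val L y ⬝ᵥ w.val L y) F x • outNormal K F))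

end Mesh

/-! ### Discrete functions in `L²(Ω)` -/

/-- `[L²(Ω)]^d`. -/
abbrev L2Vec {d : ℕ} (Ω : Set (E d)) := Lp (E d) 2 (volume.restrict Ω)

/-- `L²(Ω)`. -/
abbrev L2Scal {d : ℕ} (Ω : Set (E d)) := Lp ℝ 2 (volume.restrict Ω)

/-- On the element `K` the function `v` is the vector polynomial `p`, of degree at most `r`. -/
def IsVecPolyOn {d : ℕ} (r : ℕ) (K : Finset (E d)) (v : E d → E d)
    (p : Fin d → MvPolynomial (Fin d) ℝ) : Prop :=
  (∀ i, (p i).totalDegree ≤ r) ∧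
    ∀ᵐ x ∂(volume.restrict (interior (hull K))), ∀ i, v x i = MvPolynomial.eval x.ofLp (p i)

/-- On the element `K` the function `q` is the polynomial `p`, of degree at most `k`. -/
def IsScalPolyOn {d : ℕ} (k : ℕ) (K : Finset (E d)) (q : E d → ℝ)
    (p : MvPolynomial (Fin d) ℝ) : Prop :=
  p.totalDegree ≤ k ∧
    ∀ᵐ x ∂(volume.restrict (interior (hull K))), q x = MvPolynomial.eval x.ofLp p

open Classical in
/-- The element-wise polynomials of degree at most `r` that represent `v`. -/
def vecPoly {d : ℕ} (r : ℕ) (v : E d → E d) : VecField d :=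
  fun K => if h : ∃ p, IsVecPolyOn r K v p then h.choose else 0

open Classical in
/-- The element-wise polynomials of degree at most `k` that represent `q`. -/
def scalPoly {d : ℕ} (k : ℕ) (q : E d → ℝ) : ScalField d :=
  fun K => if h : ∃ p, IsScalPolyOn k K q p then h.choose else 0

namespace Mesh

variable {d : ℕ} {Ω : Set (E d)} (M : Mesh Ω)

/-- `V_h` is a space of piecewise polynomial vector fields of degree at most `r`. -/
def IsVelocitySpace (r : ℕ) (Vh : Submodule ℝ (L2Vec Ω)) : Prop :=
  ∀ v ∈ Vh, ∀ K ∈ M.elems, ∃ p, IsVecPolyOn r K v p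

/-- `Q_h` is a space of piecewise polynomials of degree at most `k` with mean value zero. -/
def IsPressureSpace (k : ℕ) (Qh : Submodule ℝ (L2Scal Ω)) : Prop :=
  ∀ q ∈ Qh, (∫ x in Ω, q x) = 0 ∧ ∀ K ∈ M.elems, ∃ p, IsScalPolyOn k K q p

end Mesh

/-- The data of the semi-discrete scheme: strain tensor, viscosity, penalty parameters, polynomial
degrees of velocity and pressure, discrete spaces, and penalty form. -/
structure Scheme {d : ℕ} {Ω : Set (E d)} (M : Mesh Ω) where
  κ : StressKind
  ν : ℝ
  η : Finset (E d) → ℝ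
  ζ : Finset (E d) → ℝ
  r : ℕ
  k : ℕ
  Vh : Submodule ℝ (L2Vec Ω)
  Qh : Submodule ℝ (L2Scal Ω)
  dh : L2Vec Ω → L2Vec Ω → ℝ

namespace Scheme

variable {d : ℕ} {Ω : Set (E d)} {M : Mesh Ω} (S : Scheme M)

/-- `N_h(u; v) = c_h(u; u, v) + ν a_h(u, v) + d_h(u, v)`. -/
def formN (u v : L2Vec Ω) : ℝ :=
  M.formC S.ζ (vecPoly S.r u) (vecPoly S.r u) (vecPoly S.r v)
  + S.ν * M.formA S.κ S.η (vecPoly S.r u) (vecPoly S.r v)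
  + S.dh u v

/-- `b_h(v, q)` for discrete functions. -/
def formB (v : L2Vec Ω) (q : L2Scal Ω) : ℝ :=
  M.formB (vecPoly S.r v) (scalPoly S.k q)

/-- The equations of the scheme at the time `t ∈ (0, T]` (with a one-sided time derivative at
`t = T`). -/
def HoldsAt (T : ℝ) (f u : ℝ → L2Vec Ω) (p : ℝ → L2Scal Ω) (t : ℝ) : Prop :=
  (∃ u' : L2Vec Ω, HasDerivWithinAt u u' (Icc 0 T) t ∧
    ∀ v ∈ S.Vh, inner ℝ u' v + S.formN (u t) v - S.formB v (p t) = inner ℝ (f t) v) ∧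
  ∀ q ∈ S.Qh, S.formB (u t) q = 0

/-- Solutions of the semi-discrete scheme on `[0, T]`: either in the classical sense (`u` is
continuous and the equations hold at every `t ∈ (0, T]`), or in the sense of Carathéodory (`u` is
absolutely continuous and the equations hold at almost every `t`). -/
def IsSolution (T : ℝ) (f u : ℝ → L2Vec Ω) (p : ℝ → L2Scal Ω) : Prop :=
  (∀ t ∈ Icc 0 T, u t ∈ S.Vh) ∧ (∀ t ∈ Ioc 0 T, p t ∈ S.Qh) ∧
  ((ContinuousOn u (Icc 0 T) ∧ ∀ t ∈ Ioc 0 T, S.HoldsAt T f u p t) ∨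
    (AbsolutelyContinuousOnInterval u 0 T ∧
      ∀ᵐ t ∂(volume.restrict (Ioc 0 T)), S.HoldsAt T f u p t))

end Scheme

end UnifiedNS

end

/-!
The scheme is tested with the solution itself. The pressure drops out because `b_h(u, p) = 0`, so
that `(∂ₜu, u) + N_h(u; u) = (f, u)`. Once `N_h(u; u) ≥ 0` is known, the derivative of `‖u‖` is at
most `‖f‖`; to avoid the zeros of `u` this is carried out for `√(‖u‖² + ε²)`, and `ε → 0`
(`norm_le_of_energy_classical`, `norm_le_of_energy_ae`).

Two facts about polynomials on a simplex enter the proof of `N_h(u; u) ≥ 0`. Both come from one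
formula (`integral_cone`): if `F` lies in a hyperplane at distance `H` from the point `a`, the
integral of `g` over the cone with base `F` and apex `a` is
`H ∫_F ∫_0^1 t^(d-1) g(a + t (x - a)) dt dF(x)`.

* The divergence theorem (`IsSimplex.integral_pderiv`). For the field `(x - a) g`, with `a` a vertex,
  it is the fundamental theorem of calculus on the rays from `a`. Any constant vector is a
  combination `∑ c_a (x - a)` over the vertices, with `∑ c_a = 0`, which gives the general case.
* The trace inequality `H ∫_F q² ≤ C ∫_K q²` for `q` of degree at most `r`
  (`IsSimplex.surfInt_sq_le`). On each ray it is an inequality between norms on the finite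
  dimensional space of polynomials of degree at most `r` in one variable
  (`exists_sq_eval_one_le`). Shape regularity enters only through `h_F ≤ σ H`.

All sums of integrals over element boundaries are regrouped face by face
(`Mesh.bdrySum_nonneg`); conformity of the mesh makes the two normals on an interior face opposite
(`outNormal_eq_neg`). For the convective form (`Mesh.formC_nonneg`) the volume terms are half the
integral of `-div(|u|² u)`, and on each face their flux cancels the central flux and the correction
term up to the nonnegative upwind term; on the boundary a remainder `½ (u·n) |u|²` is absorbed since
`ζ ≥ ½`. For the viscous form (`Mesh.formA_nonneg`) one has `τ(v) : ∇v ≥ ½ |τ(v)|²` pointwise, which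
uses `d ≤ 3` for the third tensor; the consistency terms on the faces are split by Young's inequality
between the penalty term and `h_F ∫_F |τ(v)|²`, and the trace inequality bounds the latter by
`½ ∫ |τ(v)|²`.
-/

namespace UnifiedNS

/-! ### Integration over cones -/

/-- The coordinates (height over `a` in the direction `n`, position in the orthogonal hyperplane). -/
theorem measurePreserving_slab {d : ℕ} (a n : E d) (hn : ‖n‖ = 1) :
    MeasurePreserving (fun p : ℝ × (ℝ ∙ n)ᗮ => a + (p.1 • n + (p.2 : E d))) := by
  have h1 := ((ℝ ∙ n).measurePreserving_measurableEquivProd a).symm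
  rw [InnerProductSpace.euclideanHausdorffMeasure_eq_volume] at h1
  have h2 : MeasurePreserving
      (Prod.map (LinearIsometryEquiv.toSpanUnitSingleton (𝕜 := ℝ) n hn)
        (id : (ℝ ∙ n)ᗮ → (ℝ ∙ n)ᗮ)) :=
    (LinearIsometryEquiv.measurePreserving _).prod (MeasurePreserving.id _)
  convert! h1.comp h2 using 1
  ext p : 1
  simp [LinearIsometryEquiv.toSpanUnitSingleton, add_comm]

theorem measurableEmbedding_slab {d : ℕ} (a n : E d) (hn : ‖n‖ = 1) :
    MeasurableEmbedding (fun p : ℝ × (ℝ ∙ n)ᗮ => a + (p.1 • n + (p.2 : E d))) := by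
  refine Continuous.measurableEmbedding (by fun_prop) ?_
  rintro ⟨s, w⟩ ⟨s', w'⟩ h
  have hnn : inner ℝ n n = (1 : ℝ) := by simp [hn]
  have hw (w : (ℝ ∙ n)ᗮ) : inner ℝ n (w : E d) = 0 :=
    Submodule.mem_orthogonal_singleton_iff_inner_right.1 w.2
  have h' : s • n + (w : E d) = s' • n + (w' : E d) := by simpa using h
  have hs : s = s' := by
    have := congrArg (fun x => inner ℝ n x) h'
    simpa only [inner_add_right, inner_smul_right, hnn, hw, mul_one, add_zero] using this
  subst hs
  have : (w : E d) = w' := by simpa using h'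
  simp [Subtype.ext this]

theorem isometry_plane {d : ℕ} (b : E d) (W : Submodule ℝ (E d)) :
    Isometry (fun w : W => b + (w : E d)) :=
  (IsometryEquiv.addLeft b).isometry.comp isometry_subtype_coe

theorem finrank_orthogonal_unit {d : ℕ} {n : E d} (hn : ‖n‖ = 1) :
    Module.finrank ℝ (ℝ ∙ n)ᗮ = d - 1 := by
  have h := (ℝ ∙ n).finrank_add_finrank_orthogonal
  have hn0 : n ≠ 0 := by rintro rfl; simp at hn
  rw [finrank_span_singleton hn0, finrank_euclideanSpace, Fintype.card_fin] at h
  omega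

/-- On the hyperplane through `b` orthogonal to the unit vector `n`, the `(d-1)`-dimensional
Hausdorff measure is Lebesgue measure. -/
theorem map_plane_volume {d : ℕ} {n : E d} (hn : ‖n‖ = 1) (b : E d) :
    (volume : Measure (ℝ ∙ n)ᗮ).map (fun w : (ℝ ∙ n)ᗮ => b + (w : E d)) =
      (Measure.euclideanHausdorffMeasure (d - 1)).restrict
        (range (fun w : (ℝ ∙ n)ᗮ => b + (w : E d))) := by
  rw [← (isometry_plane b _).map_euclideanHausdorffMeasure, ← finrank_orthogonal_unit hn,
    InnerProductSpace.euclideanHausdorffMeasure_eq_volume]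

theorem mem_range_plane {d : ℕ} {n : E d} {b x : E d} (h : inner ℝ n (x - b) = 0) :
    x ∈ range (fun w : (ℝ ∙ n)ᗮ => b + (w : E d)) :=
  ⟨⟨x - b, Submodule.mem_orthogonal_singleton_iff_inner_right.2 h⟩, by simp⟩

theorem restrict_plane_eq_map {d : ℕ} {n : E d} (hn : ‖n‖ = 1) (b : E d) {F : Set (E d)}
    (hF : IsCompact F) (hb : ∀ x ∈ F, inner ℝ n (x - b) = 0) :
    (Measure.euclideanHausdorffMeasure (d - 1)).restrict F =
      ((volume : Measure (ℝ ∙ n)ᗮ).restrict ((fun w : (ℝ ∙ n)ᗮ => b + (w : E d)) ⁻¹' F)).map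
        (fun w : (ℝ ∙ n)ᗮ => b + (w : E d)) := by
  have hsub : F ⊆ range (fun w : (ℝ ∙ n)ᗮ => b + (w : E d)) := fun x hx => mem_range_plane (hb x hx)
  rw [← Measure.restrict_map (isometry_plane b _).continuous.measurable hF.measurableSet,
    map_plane_volume hn, Measure.restrict_restrict hF.measurableSet, inter_eq_left.2 hsub]

theorem isCompact_preimage_plane {d : ℕ} (b : E d) (W : Submodule ℝ (E d)) {F : Set (E d)}
    (hF : IsCompact F) : IsCompact ((fun w : W => b + (w : E d)) ⁻¹' F) := by
  have hcl : Topology.IsClosedEmbedding (fun w : W => b + (w : E d)) :=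
    (isometry_plane b W).isClosedEmbedding
  exact hcl.isCompact_preimage hF

theorem measure_plane_lt_top {d : ℕ} {n : E d} (hn : ‖n‖ = 1) (b : E d) {F : Set (E d)}
    (hF : IsCompact F) (hb : ∀ x ∈ F, inner ℝ n (x - b) = 0) :
    (Measure.euclideanHausdorffMeasure (d - 1)) F < ⊤ := by
  have h := congrArg (fun μ : Measure (E d) => μ univ) (restrict_plane_eq_map hn b hF hb)
  simp only [Measure.restrict_apply_univ] at h
  rw [h, Measure.map_apply (isometry_plane b _).continuous.measurable MeasurableSet.univ]
  simpa using (isCompact_preimage_plane b _ hF).measure_lt_top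

theorem setIntegral_plane {d : ℕ} {n : E d} (hn : ‖n‖ = 1) (b : E d) {F : Set (E d)}
    (hF : IsCompact F) (hb : ∀ x ∈ F, inner ℝ n (x - b) = 0) (g : E d → ℝ) :
    ∫ x in F, g x ∂(Measure.euclideanHausdorffMeasure (d - 1)) =
      ∫ w in (fun w : (ℝ ∙ n)ᗮ => b + (w : E d)) ⁻¹' F, g (b + w) := by
  rw [restrict_plane_eq_map hn b hF hb]
  exact (isometry_plane b _).isClosedEmbedding.measurableEmbedding.integral_map g

/-- The cone over `F` with apex `a`. -/
def cone {d : ℕ} (a : E d) (F : Set (E d)) : Set (E d) :=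
  (fun p : ℝ × E d => a + p.1 • (p.2 - a)) '' (Icc 0 1 ×ˢ F)

theorem isCompact_cone {d : ℕ} (a : E d) {F : Set (E d)} (hF : IsCompact F) :
    IsCompact (cone a F) :=
  (isCompact_Icc.prod hF).image (by fun_prop)

open scoped Pointwise in
/-- **Integration over a cone** by integrating along the rays from the apex `a` to the base `F`,
which lies in the hyperplane at distance `H` from `a`. -/
theorem integral_cone {d : ℕ} {n : E d} (hn : ‖n‖ = 1) (a : E d) {H : ℝ} (hH : 0 < H)
    {F : Set (E d)} (hF : IsCompact F) (hb : ∀ x ∈ F, inner ℝ n (x - a) = H)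
    {g : E d → ℝ} (hg : Continuous g) :
    ∫ x in cone a F, g x =
      H * ∫ x in F, (∫ t in (0 : ℝ)..1, t ^ (d - 1) * g (a + t • (x - a)))
        ∂(Measure.euclideanHausdorffMeasure (d - 1)) := by
  set W : Submodule ℝ (E d) := (ℝ ∙ n)ᗮ with hW
  have hnn : inner ℝ n n = (1 : ℝ) := by simp [hn]
  have hw (w : W) : inner ℝ n (w : E d) = 0 :=
    Submodule.mem_orthogonal_singleton_iff_inner_right.1 w.2
  have hb' : ∀ x ∈ F, inner ℝ n (x - (a + H • n)) = 0 := by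
    intro x hx
    rw [← sub_sub, inner_sub_right, hb x hx, inner_smul_right, hnn]; ring
  set F' : Set W := (fun w : W => (a + H • n) + (w : E d)) ⁻¹' F with hF'
  have hF'c : IsCompact F' := isCompact_preimage_plane _ _ hF
  rw [setIntegral_plane hn (a + H • n) hF hb']
  -- the slice of the cone at height `t * H` is the base scaled by `t`
  have slice : ∀ t : ℝ, 0 < t → t ≤ 1 → ∀ w : W,
      a + ((t * H) • n + (w : E d)) ∈ cone a F ↔ w ∈ t • F' := by
    intro t ht ht1 w
    constructor
    · rintro ⟨⟨s, x⟩, ⟨hs, hx⟩, h⟩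
      simp only [add_right_inj] at h
      have hst : s = t := by
        have := congrArg (fun x => inner ℝ n x) h
        simp only [inner_smul_right, inner_add_right, hnn, hw, hb x hx] at this
        have h2 : s * H = t * H := by linarith
        exact mul_right_cancel₀ hH.ne' h2
      subst hst
      refine ⟨s⁻¹ • w, ?_, by simp [smul_smul, ht.ne']⟩
      have hxe : x = a + H • n + ((s⁻¹ • w : W) : E d) := by
        have h3 : x - a = s⁻¹ • ((s * H) • n + (w : E d)) := by
          rw [← h, smul_smul, inv_mul_cancel₀ ht.ne', one_smul]
        rw [smul_add, smul_smul, inv_mul_cancel_left₀ ht.ne'] at h3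
        rw [Submodule.coe_smul, add_assoc, ← h3]; abel
      simpa [F', hxe] using hx
    · rintro ⟨w', hw', rfl⟩
      refine ⟨(t, a + H • n + w'), ⟨⟨ht.le, ht1⟩, hw'⟩, ?_⟩
      simp only [add_right_inj, Submodule.coe_smul, mul_smul, ← smul_add]
      congr 1; abel
  have slice_empty : ∀ t : ℝ, t ∉ Icc (0 : ℝ) 1 → ∀ w : W,
      a + ((t * H) • n + (w : E d)) ∉ cone a F := by
    rintro t ht w ⟨⟨s, x⟩, ⟨hs, hx⟩, h⟩
    simp only [add_right_inj] at h
    have := congrArg (fun x => inner ℝ n x) h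
    simp only [inner_smul_right, inner_add_right, hnn, hw, hb x hx] at this
    have h2 : s * H = t * H := by linarith
    exact ht (mul_right_cancel₀ hH.ne' h2 ▸ hs)
  have hconeM := (isCompact_cone a hF).measurableSet
  -- Fubini in the coordinates (height, position in the hyperplane)
  have step1 : ∫ x in cone a F, g x =
      ∫ s : ℝ, ∫ w : W, (cone a F).indicator g (a + (s • n + (w : E d))) := by
    rw [← integral_indicator hconeM,
      ← (measurePreserving_slab a n hn).integral_comp (measurableEmbedding_slab a n hn),
      Measure.volume_eq_prod, integral_prod]
    rw [← Measure.volume_eq_prod]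
    have hi : Integrable ((cone a F).indicator g) := by
      rw [integrable_indicator_iff hconeM]
      exact hg.continuousOn.integrableOn_compact (isCompact_cone a hF)
    exact ((measurePreserving_slab a n hn).integrable_comp_emb
      (measurableEmbedding_slab a n hn)).2 hi
  have step2 : ∫ s : ℝ, ∫ w : W, (cone a F).indicator g (a + (s • n + (w : E d))) =
      H * ∫ t : ℝ, ∫ w : W, (cone a F).indicator g (a + ((t * H) • n + (w : E d))) := by
    have := Measure.integral_comp_mul_right
      (fun s : ℝ => ∫ w : W, (cone a F).indicator g (a + (s • n + (w : E d)))) H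
    rw [this, abs_of_pos (inv_pos.2 hH), smul_eq_mul, mul_inv_cancel_left₀ hH.ne']
  have step3 : ∫ t : ℝ, ∫ w : W, (cone a F).indicator g (a + ((t * H) • n + (w : E d))) =
      ∫ t in Ioc (0 : ℝ) 1, ∫ w in F', t ^ (d - 1) * g (a + t • (a + H • n + w - a)) := by
    have h0 : ∫ t : ℝ, ∫ w : W, (cone a F).indicator g (a + ((t * H) • n + (w : E d))) =
      ∫ t in Icc (0 : ℝ) 1, ∫ w : W, (cone a F).indicator g (a + ((t * H) • n + (w : E d))) := by
      refine (setIntegral_eq_integral_of_forall_compl_eq_zero fun t ht => ?_).symm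
      simp [indicator_of_notMem (slice_empty t ht _)]
    rw [h0, integral_Icc_eq_integral_Ioc]
    refine setIntegral_congr_fun measurableSet_Ioc fun t ht => ?_
    have ht0 : t ≠ 0 := ht.1.ne'
    have h1 : ∀ w : W, (cone a F).indicator g (a + ((t * H) • n + (w : E d))) =
        (t • F').indicator (fun w : W => g (a + ((t * H) • n + (w : E d)))) w := by
      intro w
      by_cases h : w ∈ t • F'
      · rw [indicator_of_mem h, indicator_of_mem ((slice t ht.1 ht.2 w).2 h)]
      · rw [indicator_of_notMem h, indicator_of_notMem (mt (slice t ht.1 ht.2 w).1 h)]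
    simp only [h1]
    rw [integral_indicator (hF'c.smul t).measurableSet, integral_const_mul]
    have h2 := Measure.setIntegral_comp_smul_of_pos (μ := (volume : Measure W))
      (fun w : W => g (a + ((t * H) • n + (w : E d)))) F' ht.1
    rw [finrank_orthogonal_unit hn, smul_eq_mul] at h2
    have h3 : ∀ w : W, a + ((t * H) • n + ((t • w : W) : E d)) =
        a + t • (a + H • n + w - a) := by
      intro w
      rw [Submodule.coe_smul, mul_smul, ← smul_add]
      congr 2; abel
    simp only [h3] at h2
    rw [h2, mul_inv_cancel_left₀ (pow_ne_zero _ ht0)]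
  rw [step1, step2, step3, integral_integral_swap]
  · simp only [intervalIntegral.integral_of_le zero_le_one]
    rfl
  · have : IntegrableOn (fun p : ℝ × W => p.1 ^ (d - 1) * g (a + p.1 • (a + H • n + p.2 - a)))
        (Icc 0 1 ×ˢ F') (volume.prod volume) :=
      ContinuousOn.integrableOn_compact (isCompact_Icc.prod hF'c)
        (Continuous.continuousOn (by fun_prop))
    rw [Measure.prod_restrict]
    exact this.mono_set (prod_mono Ioc_subset_Icc_self le_rfl)

/-! ### Polynomials on rays -/

/-- The value at the endpoint of a polynomial of degree at most `r` is bounded by its weighted `L²`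
norm, by compactness of the unit sphere in the space of coefficients. -/
theorem exists_sq_eval_one_le (r m : ℕ) :
    ∃ C : ℝ, 0 < C ∧ ∀ P : Polynomial ℝ, P.natDegree ≤ r →
      P.eval 1 ^ 2 ≤ C * ∫ t in (0 : ℝ)..1, t ^ m * P.eval t ^ 2 := by
  let Q : (Fin (r + 1) → ℝ) → ℝ := fun c => ∫ t in (0 : ℝ)..1, t ^ m * (∑ i, c i * t ^ (i : ℕ)) ^ 2
  have hQc : Continuous Q :=
    intervalIntegral.continuous_parametric_intervalIntegral_of_continuous' (by fun_prop) 0 1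
  have hQpos : ∀ c, c ≠ 0 → 0 < Q c := by
    intro c hc
    let P : Polynomial ℝ := ∑ i : Fin (r + 1), Polynomial.C (c i) * Polynomial.X ^ (i : ℕ)
    have hPe : ∀ t, P.eval t = ∑ i, c i * t ^ (i : ℕ) := by
      intro t; simp [P, Polynomial.eval_finsetSum]
    have hP0 : P ≠ 0 := by
      intro h0
      refine hc (funext fun i => ?_)
      have := congrArg (fun p => Polynomial.coeff p (i : ℕ)) h0
      simpa [P, Polynomial.finsetSum_coeff, Polynomial.coeff_C_mul, Polynomial.coeff_X_pow,
        Fin.val_inj] using this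
    obtain ⟨t, ht, ht0⟩ : ∃ t ∈ Ioo (0 : ℝ) 1, P.eval t ≠ 0 := by
      by_contra! h
      exact hP0 (Polynomial.eq_zero_of_infinite_isRoot P
        ((Ioo_infinite one_pos).mono fun t ht => h t ht))
    refine intervalIntegral.integral_pos one_pos (Continuous.continuousOn (by fun_prop))
      (fun s hs => by have := hs.1.le; positivity) ⟨t, Ioo_subset_Icc_self ht, ?_⟩
    rw [← hPe]
    have := ht.1
    positivity
  have hQs : ∀ (s : ℝ) c, Q (s • c) = s ^ 2 * Q c := by
    intro s c
    simp only [Q]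
    rw [← intervalIntegral.integral_const_mul]
    refine intervalIntegral.integral_congr fun t _ => ?_
    simp only [Pi.smul_apply, smul_eq_mul, mul_assoc, ← Finset.mul_sum]
    ring
  obtain ⟨c₀, hc₀, hmin⟩ := (isCompact_sphere (0 : Fin (r + 1) → ℝ) 1).exists_isMinOn
    ⟨fun _ => 1, by simp⟩ hQc.continuousOn
  have hκ : 0 < Q c₀ := hQpos _ (by rintro rfl; simp at hc₀)
  have hlow : ∀ c, Q c₀ * ‖c‖ ^ 2 ≤ Q c := by
    intro c
    rcases eq_or_ne c 0 with rfl | hc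
    · have h0 : Q 0 = 0 := by simpa using hQs 0 0
      rw [h0]; simp
    · have hn : ‖c‖ ≠ 0 := norm_ne_zero_iff.2 hc
      have h1 : Q c₀ ≤ Q (‖c‖⁻¹ • c) := hmin (by simp [norm_smul, hn])
      rw [hQs] at h1
      calc Q c₀ * ‖c‖ ^ 2 ≤ ‖c‖⁻¹ ^ 2 * Q c * ‖c‖ ^ 2 := by gcongr
        _ = Q c := by field_simp
  refine ⟨(r + 1) ^ 2 / Q c₀, by positivity, fun P hP => ?_⟩
  let c : Fin (r + 1) → ℝ := fun i => P.coeff i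
  have hPc : ∀ t, P.eval t = ∑ i, c i * t ^ (i : ℕ) := by
    intro t
    rw [Polynomial.eval_eq_sum_range' (Nat.lt_succ_of_le hP),
      Finset.sum_range (fun i => P.coeff i * t ^ i)]
  have h1 : |P.eval 1| ≤ (r + 1) * ‖c‖ := by
    rw [hPc]
    calc |∑ i, c i * 1 ^ (i : ℕ)| ≤ ∑ i, ‖c i‖ := by
          simpa using Finset.abs_sum_le_sum_abs (fun i => c i) Finset.univ
      _ ≤ ∑ _i : Fin (r + 1), ‖c‖ := Finset.sum_le_sum fun i _ => norm_le_pi_norm c i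
      _ = (r + 1) * ‖c‖ := by simp
  have h2 : P.eval 1 ^ 2 ≤ ((r + 1) * ‖c‖) ^ 2 := by
    rw [← sq_abs]; gcongr
  have h3 : ∫ t in (0 : ℝ)..1, t ^ m * P.eval t ^ 2 = Q c := by simp only [Q, hPc]
  rw [h3]
  calc P.eval 1 ^ 2 ≤ ((r + 1) * ‖c‖) ^ 2 := h2
    _ = (r + 1) ^ 2 / Q c₀ * (Q c₀ * ‖c‖ ^ 2) := by field_simp
    _ ≤ _ := by gcongr; exact hlow c

/-- The restriction of the polynomial `q` to the line `t ↦ a + t (x - a)`. -/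
noncomputable def rayPoly {d : ℕ} (a x : E d) (q : MvPolynomial (Fin d) ℝ) : Polynomial ℝ :=
  MvPolynomial.aeval (fun i => Polynomial.C (a i) + Polynomial.C (x i - a i) * Polynomial.X) q

theorem rayPoly_add {d : ℕ} (a x : E d) (p q : MvPolynomial (Fin d) ℝ) :
    rayPoly a x (p + q) = rayPoly a x p + rayPoly a x q := map_add _ _ _

theorem rayPoly_mul {d : ℕ} (a x : E d) (p q : MvPolynomial (Fin d) ℝ) :
    rayPoly a x (p * q) = rayPoly a x p * rayPoly a x q := map_mul _ _ _

theorem rayPoly_C {d : ℕ} (a x : E d) (c : ℝ) :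
    rayPoly a x (MvPolynomial.C c) = Polynomial.C c := MvPolynomial.aeval_C _ _

theorem rayPoly_X {d : ℕ} (a x : E d) (i : Fin d) :
    rayPoly a x (MvPolynomial.X i) =
      Polynomial.C (a i) + Polynomial.C (x i - a i) * Polynomial.X := MvPolynomial.aeval_X _ _

theorem eval_rayPoly {d : ℕ} (a x : E d) (q : MvPolynomial (Fin d) ℝ) (t : ℝ) :
    (rayPoly a x q).eval t = MvPolynomial.eval (a + t • (x - a)).ofLp q := by
  induction q using MvPolynomial.induction_on with
  | C c => simp [rayPoly_C]
  | add p q hp hq => rw [rayPoly_add, Polynomial.eval_add, hp, hq, map_add]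
  | mul_X p i hp =>
    rw [rayPoly_mul, rayPoly_X, Polynomial.eval_mul, hp, map_mul, MvPolynomial.eval_X]
    simp [mul_comm]

theorem natDegree_rayPoly_le {d : ℕ} (a x : E d) (q : MvPolynomial (Fin d) ℝ) :
    (rayPoly a x q).natDegree ≤ q.totalDegree := by
  rw [rayPoly, MvPolynomial.aeval_def, MvPolynomial.eval₂_eq]
  refine Polynomial.natDegree_sum_le_of_forall_le _ _ fun s hs => ?_
  refine (Polynomial.natDegree_C_mul_le _ _).trans ((Polynomial.natDegree_prod_le _ _).trans ?_)
  refine le_trans (Finset.sum_le_sum (g := fun i => s i) fun i _ => ?_)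
    (MvPolynomial.le_totalDegree hs)
  refine Polynomial.natDegree_pow_le.trans ?_
  have : (Polynomial.C (a i) + Polynomial.C (x i - a i) * Polynomial.X).natDegree ≤ 1 := by
    compute_degree
  nlinarith

theorem derivative_rayPoly {d : ℕ} (a x : E d) (q : MvPolynomial (Fin d) ℝ) :
    Polynomial.derivative (rayPoly a x q) =
      ∑ i, Polynomial.C (x i - a i) * rayPoly a x (MvPolynomial.pderiv i q) := by
  induction q using MvPolynomial.induction_on with
  | C c => simp [rayPoly]
  | add p q hp hq =>
    simp only [map_add, rayPoly_add, mul_add, Finset.sum_add_distrib]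
    rw [hp, hq]
  | mul_X p j hp =>
    simp only [rayPoly_mul, Polynomial.derivative_mul, MvPolynomial.pderiv_mul, rayPoly_add,
      mul_add, Finset.sum_add_distrib]
    rw [hp, Finset.sum_mul]
    congr 1
    · exact Finset.sum_congr rfl fun i _ => mul_assoc _ _ _
    · have hX : Polynomial.derivative (rayPoly a x (MvPolynomial.X j)) =
          Polynomial.C (x j - a j) := by
        simp [rayPoly_X]
      rw [hX, Finset.sum_eq_single j]
      · rw [MvPolynomial.pderiv_X_self, ← MvPolynomial.C_1, rayPoly_C, Polynomial.C_1, mul_one,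
          mul_comm]
      · intro i _ hij
        rw [MvPolynomial.pderiv_X_of_ne hij.symm, ← MvPolynomial.C_0, rayPoly_C, Polynomial.C_0,
          mul_zero, mul_zero]
      · intro h; exact absurd (Finset.mem_univ j) h

theorem hasDerivAt_eval_ray {d : ℕ} (a x : E d) (q : MvPolynomial (Fin d) ℝ) (t : ℝ) :
    HasDerivAt (fun t : ℝ => MvPolynomial.eval (a + t • (x - a)).ofLp q)
      (∑ i, (x i - a i) * MvPolynomial.eval (a + t • (x - a)).ofLp (MvPolynomial.pderiv i q)) t := by
  have h := (rayPoly a x q).hasDerivAt t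
  simp only [derivative_rayPoly, Polynomial.eval_finsetSum, Polynomial.eval_mul,
    Polynomial.eval_C, eval_rayPoly] at h
  exact h

theorem continuous_eval_ofLp {d : ℕ} (q : MvPolynomial (Fin d) ℝ) :
    Continuous fun x : E d => MvPolynomial.eval x.ofLp q :=
  (MvPolynomial.continuous_eval q).comp (PiLp.continuous_ofLp 2 _)

/-- The divergence theorem for the field `(x - a) q` on a cone with apex `a`: this field is
tangent to the lateral boundary, and its normal component on the base is `H q`. -/
theorem integral_cone_div {d : ℕ} (hd : 0 < d) {n : E d} (hn : ‖n‖ = 1) (a : E d) {H : ℝ}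
    (hH : 0 < H) {F : Set (E d)} (hF : IsCompact F) (hb : ∀ x ∈ F, inner ℝ n (x - a) = H)
    (q : MvPolynomial (Fin d) ℝ) :
    ∫ x in cone a F, (d * MvPolynomial.eval x.ofLp q +
        ∑ i, (x i - a i) * MvPolynomial.eval x.ofLp (MvPolynomial.pderiv i q)) =
      H * ∫ x in F, MvPolynomial.eval x.ofLp q ∂(Measure.euclideanHausdorffMeasure (d - 1)) := by
  have hc := continuous_eval_ofLp (d := d)
  rw [integral_cone hn a hH hF hb (by fun_prop)]
  congr 1
  refine setIntegral_congr_fun hF.measurableSet fun x _ => ?_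
  have hder : ∀ t : ℝ, HasDerivAt (fun t : ℝ => t ^ d * MvPolynomial.eval (a + t • (x - a)).ofLp q)
      (t ^ (d - 1) * (d * MvPolynomial.eval (a + t • (x - a)).ofLp q +
        ∑ i, ((a + t • (x - a)) i - a i) *
          MvPolynomial.eval (a + t • (x - a)).ofLp (MvPolynomial.pderiv i q))) t := by
    intro t
    convert! (hasDerivAt_pow d t).mul (hasDerivAt_eval_ray a x q t) using 1
    have ht : t ^ d = t ^ (d - 1) * t := by rw [← pow_succ, Nat.sub_add_cancel hd]
    rw [mul_add, ht, Finset.mul_sum, Finset.mul_sum]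
    congr 1
    · ring
    · refine Finset.sum_congr rfl fun i _ => ?_
      simp only [PiLp.add_apply, PiLp.smul_apply, PiLp.sub_apply, smul_eq_mul]
      ring
  have hray : ∀ p : MvPolynomial (Fin d) ℝ,
      Continuous fun t : ℝ => MvPolynomial.eval (a + t • (x - a)).ofLp p :=
    fun p => (hc p).comp (by fun_prop)
  have := intervalIntegral.integral_eq_sub_of_hasDerivAt (a := 0) (b := 1)
    (fun t _ => hder t) (Continuous.intervalIntegrable (by fun_prop) _ _)
  simp only [this]
  simp [hd.ne']

/-! ### Geometry of simplices -/

/-- `K` is the vertex set of a nondegenerate `d`-simplex. -/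
structure IsSimplex {d : ℕ} (K : Finset (E d)) : Prop where
  card_eq : K.card = d + 1
  indep : AffineIndependent ℝ ((↑) : K → E d)

theorem Mesh.isSimplex {d : ℕ} {Ω : Set (E d)} (M : Mesh Ω) {K : Finset (E d)}
    (hK : K ∈ M.elems) : IsSimplex K :=
  ⟨M.card_eq K hK, M.indep K hK⟩

namespace IsSimplex

variable {d : ℕ} {K : Finset (E d)}

/-- The vertices of a simplex as an affine basis of `ℝ^d`. -/
noncomputable def basis (hK : IsSimplex K) : AffineBasis K ℝ (E d) where
  toFun := (↑)
  ind' := hK.indep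
  tot' := by
    rw [hK.indep.affineSpan_eq_top_iff_card_eq_finrank_add_one]
    simp [hK.card_eq]

@[simp] theorem basis_apply (hK : IsSimplex K) (a : K) : hK.basis a = a := rfl

open Classical in
/-- The barycentric coordinate of the vertex `a`, with the junk value `0` if `a` is no vertex. -/
noncomputable def coord (hK : IsSimplex K) (a : E d) : E d →ᵃ[ℝ] ℝ :=
  if h : a ∈ K then hK.basis.coord ⟨a, h⟩ else 0

theorem coord_self (hK : IsSimplex K) {a : E d} (ha : a ∈ K) : hK.coord a a = 1 := by
  simpa [coord, ha] using hK.basis.coord_apply_eq ⟨a, ha⟩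

theorem coord_ne (hK : IsSimplex K) {a b : E d} (hb : b ∈ K) (hab : a ≠ b) :
    hK.coord a b = 0 := by
  by_cases ha : a ∈ K
  · simpa [coord, ha] using hK.basis.coord_apply_ne (i := ⟨a, ha⟩) (j := ⟨b, hb⟩) (by simpa using hab)
  · simp [coord, ha]

theorem sum_coord (hK : IsSimplex K) (x : E d) : ∑ a ∈ K, hK.coord a x = 1 := by
  rw [← hK.basis.sum_coord_apply_eq_one x, ← Finset.sum_coe_sort K]
  exact Finset.sum_congr rfl fun a _ => by simp [coord]

theorem sum_coord_smul (hK : IsSimplex K) (x : E d) : ∑ a ∈ K, hK.coord a x • a = x := by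
  conv_rhs => rw [← hK.basis.linear_combination_coord_eq_self x]
  rw [← Finset.sum_coe_sort K]
  exact Finset.sum_congr rfl fun a _ => by simp [coord]

theorem coord_sum (hK : IsSimplex K) {s : Finset (E d)} {w : E d → ℝ} (hw : ∑ u ∈ s, w u = 1)
    (v : E d) : hK.coord v (∑ u ∈ s, w u • u) = ∑ u ∈ s, w u * hK.coord v u := by
  obtain ⟨c, h⟩ : ∃ c, ∀ x, hK.coord v x = (hK.coord v).linear x + c :=
    ⟨hK.coord v 0, fun x => congrFun (hK.coord v).decomp x⟩
  simp only [h, map_sum, mul_add, Finset.sum_add_distrib, ← Finset.sum_mul, hw, map_smul, smul_eq_mul,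
    one_mul]

theorem mem_hull (hK : IsSimplex K) {x : E d} (hx : ∀ a ∈ K, 0 ≤ hK.coord a x) : x ∈ hull K := by
  rw [← hK.sum_coord_smul x]
  exact (convex_convexHull ℝ _).sum_mem hx (hK.sum_coord x) fun a ha => subset_convexHull ℝ _ ha

theorem inner_sub_eq_sum (hK : IsSimplex K) (n x y : E d) :
    inner ℝ n (x - y) = ∑ a ∈ K, hK.coord a x * inner ℝ n (a - y) := by
  have h : x - y = ∑ a ∈ K, hK.coord a x • (a - y) := by
    simp only [smul_sub, Finset.sum_sub_distrib, hK.sum_coord_smul, ← Finset.sum_smul,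
      hK.sum_coord, one_smul]
  conv_lhs => rw [h]
  simp [inner_sum, inner_smul_right]

open Classical in
/-- A vector that is orthogonal to the face opposite to `a` is a multiple of the gradient of the
barycentric coordinate of `a`. -/
theorem inner_sub_eq_coord_mul (hK : IsSimplex K) {a : E d} (ha : a ∈ K) {n y : E d}
    (hn : ∀ x ∈ K.erase a, inner ℝ n (x - y) = 0) (x : E d) :
    inner ℝ n (x - y) = hK.coord a x * inner ℝ n (a - y) := by
  rw [hK.inner_sub_eq_sum, ← Finset.add_sum_erase _ _ ha, Finset.sum_eq_zero, add_zero]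
  intro b hb
  rw [hn b hb, mul_zero]

open Classical in
theorem erase_nonempty (hK : IsSimplex K) (hd : 0 < d) {a : E d} (ha : a ∈ K) :
    (K.erase a).Nonempty := by
  rw [← Finset.card_pos, Finset.card_erase_of_mem ha, hK.card_eq]; omega

end IsSimplex

/-- The outward unit normal as a vector of Euclidean space. -/
noncomputable def unitNormal {d : ℕ} (K F : Finset (E d)) : E d := WithLp.toLp 2 (outNormal K F)

theorem inner_unitNormal {d : ℕ} (K F : Finset (E d)) (x : E d) :
    inner ℝ (unitNormal K F) x = outNormal K F ⬝ᵥ x.ofLp := by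
  rw [EuclideanSpace.inner_eq_star_dotProduct, dotProduct_comm]; simp [unitNormal]

namespace IsSimplex

variable {d : ℕ} {K : Finset (E d)}

open Classical in
theorem unitNormal_spec (hK : IsSimplex K) (hd : 0 < d) {a : E d} (ha : a ∈ K) :
    ‖unitNormal K (K.erase a)‖ = 1 ∧
    (∀ x ∈ K.erase a, ∀ y ∈ K.erase a, inner ℝ (unitNormal K (K.erase a)) (x - y) = 0) ∧
    (∀ x ∈ K, ∀ y ∈ K.erase a, inner ℝ (unitNormal K (K.erase a)) (x - y) ≤ 0) := by
  refine Classical.epsilon_spec (p := fun n : E d => ‖n‖ = 1 ∧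
    (∀ x ∈ K.erase a, ∀ y ∈ K.erase a, inner ℝ n (x - y) = 0) ∧
    (∀ x ∈ K, ∀ y ∈ K.erase a, inner ℝ n (x - y) ≤ 0)) ?_
  obtain ⟨y₀, hy₀⟩ := hK.erase_nonempty hd ha
  -- minus the normalized gradient of the barycentric coordinate of `a`
  let v : E d := (InnerProductSpace.toDual ℝ (E d)).symm
    (LinearMap.toContinuousLinearMap (hK.coord a).linear)
  have hv : ∀ x y : E d, inner ℝ v (x - y) = hK.coord a x - hK.coord a y := by
    intro x y
    have h := (hK.coord a).linearMap_vsub x y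
    simp only [vsub_eq_sub] at h
    rw [← h]; simp [v]
  have hcoord : ∀ y ∈ K.erase a, hK.coord a y = 0 := fun y hy =>
    hK.coord_ne (Finset.mem_of_mem_erase hy) (Finset.ne_of_mem_erase hy).symm
  have hv0 : v ≠ 0 := by
    intro h0
    have := hv a y₀
    simp [h0, hK.coord_self ha, hcoord y₀ hy₀] at this
  have hv' : 0 < ‖v‖ := norm_pos_iff.2 hv0
  refine ⟨-(‖v‖⁻¹ • v), by simp [norm_smul, hv'.ne'], fun x hx y hy => ?_, fun x hx y hy => ?_⟩
  · rw [inner_neg_left, inner_smul_left, hv, hcoord x hx, hcoord y hy]; simp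
  · rw [inner_neg_left, inner_smul_left, hv, hcoord y hy]
    have : 0 ≤ hK.coord a x := by
      rcases eq_or_ne x a with rfl | h
      · simp [hK.coord_self ha]
      · rw [hK.coord_ne hx h.symm]
    simp only [sub_zero, map_inv₀, conj_trivial, Left.neg_nonpos_iff]
    positivity

open Classical in
/-- The outward normal is minus the gradient of a barycentric coordinate, times the height. -/
theorem exists_height (hK : IsSimplex K) (hd : 0 < d) {a : E d} (ha : a ∈ K) :
    ∃ H : ℝ, 0 < H ∧ ∀ x, inner ℝ (unitNormal K (K.erase a)) (x - a) = H * (1 - hK.coord a x) := by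
  obtain ⟨hn1, hn2, hn3⟩ := hK.unitNormal_spec hd ha
  set n := unitNormal K (K.erase a)
  obtain ⟨y, hy⟩ := hK.erase_nonempty hd ha
  have hx := hK.inner_sub_eq_coord_mul ha (fun x hx => hn2 x hx y hy)
  have hle := hn3 a ha y hy
  have hne : inner ℝ n (a - y) ≠ 0 := by
    intro h0
    have := hx (y + n)
    simp [h0, hn1] at this
  refine ⟨-inner ℝ n (a - y), by linarith [lt_of_le_of_ne hle hne], fun x => ?_⟩
  rw [← sub_sub_sub_cancel_right x a y, inner_sub_right, hx x]
  ring

open Classical in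
/-- The height of the simplex over the face opposite to `a`. -/
noncomputable def height (hK : IsSimplex K) (hd : 0 < d) {a : E d} (ha : a ∈ K) : ℝ :=
  (hK.exists_height hd ha).choose

theorem height_pos (hK : IsSimplex K) (hd : 0 < d) {a : E d} (ha : a ∈ K) :
    0 < hK.height hd ha := (hK.exists_height hd ha).choose_spec.1

open Classical in
theorem inner_unitNormal_sub (hK : IsSimplex K) (hd : 0 < d) {a : E d} (ha : a ∈ K) (x : E d) :
    inner ℝ (unitNormal K (K.erase a)) (x - a) = hK.height hd ha * (1 - hK.coord a x) :=
  (hK.exists_height hd ha).choose_spec.2 x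

end IsSimplex

theorem isCompact_hull {d : ℕ} (F : Finset (E d)) : IsCompact (hull F) :=
  F.finite_toSet.isCompact_convexHull ℝ

/-- An affine equality on vertices extends to the hull. -/
theorem inner_eq_of_mem_hull {d : ℕ} {F : Finset (E d)} {n b : E d} {H : ℝ}
    (h : ∀ x ∈ F, inner ℝ n (x - b) = H) {x : E d} (hx : x ∈ hull F) : inner ℝ n (x - b) = H := by
  have hconv : Convex ℝ {x : E d | inner ℝ n (x - b) = H} := by
    have : {x : E d | inner ℝ n (x - b) = H} = {x | innerSL ℝ n x = H + inner ℝ n b} := by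
      ext x; simp [inner_sub_right, sub_eq_iff_eq_add]
    rw [this]
    exact convex_hyperplane (innerSL ℝ n).isLinear _
  exact convexHull_min (fun x hx => h x hx) hconv hx

theorem inner_le_of_mem_hull {d : ℕ} {F : Finset (E d)} {n b : E d} {H : ℝ}
    (h : ∀ x ∈ F, inner ℝ n (x - b) ≤ H) {x : E d} (hx : x ∈ hull F) : inner ℝ n (x - b) ≤ H := by
  have hconv : Convex ℝ {x : E d | inner ℝ n (x - b) ≤ H} := by
    have : {x : E d | inner ℝ n (x - b) ≤ H} = {x | innerSL ℝ n x ≤ H + inner ℝ n b} := by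
      ext x; simp [inner_sub_right]
    rw [this]
    exact convex_halfSpace_le (innerSL ℝ n).isLinear _
  exact convexHull_min (fun x hx => h x hx) hconv hx

open Classical in
theorem hull_eq_cone {d : ℕ} {K : Finset (E d)} {a : E d} (ha : a ∈ K)
    (hne : (K.erase a).Nonempty) : hull K = cone a (hull (K.erase a)) := by
  have hK : (K : Set (E d)) = insert a (K.erase a : Set (E d)) := by
    rw [← Finset.coe_insert, Finset.insert_erase ha]
  rw [hull, hK, convexHull_insert (Finset.coe_nonempty.2 hne), convexJoin_singleton_left]
  ext x
  simp only [cone, mem_iUnion, mem_image, Prod.exists, mem_prod, segment_eq_image']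
  constructor
  · rintro ⟨y, hy, t, ht, h⟩; exact ⟨t, y, ⟨ht, hy⟩, h⟩
  · rintro ⟨t, y, ⟨ht, hy⟩, h⟩; exact ⟨y, hy, t, ht, h⟩

namespace IsSimplex

variable {d : ℕ} {K : Finset (E d)}

open Classical in
theorem inner_face (hK : IsSimplex K) (hd : 0 < d) {a : E d} (ha : a ∈ K) {x : E d}
    (hx : x ∈ hull (K.erase a)) :
    inner ℝ (unitNormal K (K.erase a)) (x - a) = hK.height hd ha := by
  refine inner_eq_of_mem_hull (fun x hx => ?_) hx
  rw [hK.inner_unitNormal_sub hd ha,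
    hK.coord_ne (Finset.mem_of_mem_erase hx) (Finset.ne_of_mem_erase hx).symm]
  ring

/-- A ball inside the simplex fits between the hyperplanes of a face and its opposite vertex. -/
theorem le_height (hK : IsSimplex K) (hd : 0 < d) {a : E d} (ha : a ∈ K) {c : E d} {ρ : ℝ}
    (hρ : 0 < ρ) (hc : Metric.closedBall c (ρ / 2) ⊆ hull K) : ρ ≤ hK.height hd ha := by
  classical
  have hn1 := (hK.unitNormal_spec hd ha).1
  set n := unitNormal K (K.erase a)
  have hnn : inner ℝ n n = (1 : ℝ) := by simp [hn1]
  have hball : ∀ s : ℝ, |s| ≤ ρ / 2 → c + s • n ∈ hull K := fun s hs => hc (by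
    simpa [norm_smul, hn1] using hs)
  have hcoord : ∀ x ∈ K, 0 ≤ hK.coord a x ∧ hK.coord a x ≤ 1 := by
    intro x hx
    rcases eq_or_ne a x with rfl | h
    · simp [hK.coord_self ha]
    · simp [hK.coord_ne hx h]
  have hH := hK.height_pos hd ha
  have h1 := inner_le_of_mem_hull (n := n) (b := a) (H := hK.height hd ha) (fun x hx => by
    rw [hK.inner_unitNormal_sub hd ha]; nlinarith [hcoord x hx])
    (hball (ρ / 2) (by rw [abs_of_pos (by linarith)]))
  have h2 := inner_le_of_mem_hull (n := -n) (b := a) (H := 0) (fun x hx => by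
    rw [inner_neg_left, hK.inner_unitNormal_sub hd ha]; nlinarith [hcoord x hx])
    (hball (-(ρ / 2)) (by rw [abs_neg, abs_of_pos (by linarith)]))
  rw [add_sub_right_comm, inner_add_right, inner_smul_right, hnn] at h1
  rw [add_sub_right_comm, inner_neg_left, inner_add_right, inner_smul_right, hnn] at h2
  linarith

open Classical in
theorem measure_face_lt_top (hK : IsSimplex K) (hd : 0 < d) {a : E d} (ha : a ∈ K) :
    (Measure.euclideanHausdorffMeasure (d - 1)) (hull (K.erase a)) < ⊤ := by
  obtain ⟨y, hy⟩ := hK.erase_nonempty hd ha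
  obtain ⟨hn1, hn2, -⟩ := hK.unitNormal_spec hd ha
  exact measure_plane_lt_top hn1 y (isCompact_hull _)
    fun x hx => inner_eq_of_mem_hull (fun x hx => hn2 x hx y hy) hx

open Classical in
theorem integrableOn_face (hK : IsSimplex K) (hd : 0 < d) {a : E d} (ha : a ∈ K) {g : E d → ℝ}
    (hg : Continuous g) :
    IntegrableOn g (hull (K.erase a)) (Measure.euclideanHausdorffMeasure (d - 1)) :=
  hg.continuousOn.integrableOn_of_subset_isCompact (isCompact_hull _)
    (isCompact_hull _).measurableSet le_rfl (hK.measure_face_lt_top hd ha).ne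

open Classical in
/-- **Trace inequality** for polynomials, from the one-dimensional inequality on the rays that
emanate from the vertex opposite to the face. -/
theorem surfInt_sq_le (hK : IsSimplex K) (hd : 0 < d) {a : E d} (ha : a ∈ K) {r : ℕ} {C : ℝ}
    (h1 : ∀ P : Polynomial ℝ, P.natDegree ≤ r →
      P.eval 1 ^ 2 ≤ C * ∫ t in (0 : ℝ)..1, t ^ (d - 1) * P.eval t ^ 2)
    {q : MvPolynomial (Fin d) ℝ} (hq : q.totalDegree ≤ r) :
    hK.height hd ha * surfInt (K.erase a) (fun x => MvPolynomial.eval x.ofLp q ^ 2) ≤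
      C * ∫ x in hull K, MvPolynomial.eval x.ofLp q ^ 2 := by
  have hH := hK.height_pos hd ha
  have hqc := continuous_eval_ofLp q
  rw [hull_eq_cone ha (hK.erase_nonempty hd ha), integral_cone (hK.unitNormal_spec hd ha).1 a hH
    (isCompact_hull _) (fun x hx => hK.inner_face hd ha hx)
      (g := fun x => MvPolynomial.eval x.ofLp q ^ 2) (hqc.pow 2),
    mul_left_comm, ← integral_const_mul, surfInt]
  refine mul_le_mul_of_nonneg_left ?_ hH.le
  refine setIntegral_mono_on (hK.integrableOn_face hd ha (hqc.pow 2))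
    (hK.integrableOn_face hd ha ?_) (isCompact_hull _).measurableSet fun x _ => ?_
  · refine continuous_const.mul
      (intervalIntegral.continuous_parametric_intervalIntegral_of_continuous' ?_ 0 1)
    have : Continuous fun p : E d × ℝ =>
        MvPolynomial.eval (a + p.2 • (p.1 - a)).ofLp q := hqc.comp (by fun_prop)
    exact ((continuous_snd.pow _).mul (this.pow 2))
  · have := h1 (rayPoly a x q) ((natDegree_rayPoly_le a x q).trans hq)
    simpa [eval_rayPoly] using this

theorem exists_eq_erase [DecidableEq (E d)] (hK : IsSimplex K) {F : Finset (E d)}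
    (hF : F ∈ K.powersetCard d) : ∃ a ∈ K, K.erase a = F := by
  obtain ⟨hFK, hF⟩ := Finset.mem_powersetCard.1 hF
  obtain ⟨a, ha⟩ := Finset.card_eq_one.1 (show (K \ F).card = 1 by
    rw [Finset.card_sdiff_of_subset hFK, hK.card_eq, hF]; omega)
  refine ⟨a, (Finset.mem_sdiff.1 (ha ▸ Finset.mem_singleton_self a)).1, ?_⟩
  rw [← Finset.sdiff_singleton_eq_erase, ← ha, Finset.sdiff_sdiff_eq_self hFK]

/-- The faces of a simplex are opposite to its vertices. -/
theorem sum_faces [DecidableEq (E d)] (hK : IsSimplex K) {α : Type*} [AddCommMonoid α]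
    (g : Finset (E d) → α) :
    ∑ F ∈ K.powersetCard d, g F = ∑ a ∈ K, g (K.erase a) := by
  refine (Finset.sum_bij (fun a _ => K.erase a) (fun a ha => ?_) (fun a ha b hb h => ?_)
    (fun F hF => ?_) (fun a _ => rfl)).symm
  · rw [Finset.mem_powersetCard]
    exact ⟨Finset.erase_subset _ _, by rw [Finset.card_erase_of_mem ha, hK.card_eq]; simp⟩
  · exact Finset.erase_injOn K ha hb h
  · obtain ⟨a, ha, h⟩ := hK.exists_eq_erase hF
    exact ⟨a, ha, h⟩

/-- **Divergence theorem** on a simplex, for a polynomial field in a coordinate direction.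
The direction is a combination of the fields `x - a` with `a` a vertex, each of which has a normal
component on one face only. -/
theorem integral_pderiv (hK : IsSimplex K) (hd : 0 < d) (j : Fin d)
    (q : MvPolynomial (Fin d) ℝ) :
    ∫ x in hull K, MvPolynomial.eval x.ofLp (MvPolynomial.pderiv j q) =
      ∑ F ∈ K.powersetCard d, surfInt F (fun x => MvPolynomial.eval x.ofLp q * outNormal K F j) := by
  classical
  have hc := continuous_eval_ofLp (d := d)
  let e : E d := EuclideanSpace.single j 1
  let c : E d → ℝ := fun a => hK.coord a 0 - hK.coord a e
  have hc0 : ∑ a ∈ K, c a = 0 := by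
    simp only [c, Finset.sum_sub_distrib, hK.sum_coord, sub_self]
  have hce : ∑ a ∈ K, c a • a = -e := by
    simp only [c, sub_smul, Finset.sum_sub_distrib, hK.sum_coord_smul, zero_sub]
  have hpt : ∀ x : E d, MvPolynomial.eval x.ofLp (MvPolynomial.pderiv j q) =
      ∑ a ∈ K, c a * (d * MvPolynomial.eval x.ofLp q +
        ∑ i, (x i - a i) * MvPolynomial.eval x.ofLp (MvPolynomial.pderiv i q)) := by
    intro x
    simp only [mul_add, Finset.sum_add_distrib, ← Finset.sum_mul, hc0, zero_mul, zero_add,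
      Finset.mul_sum]
    rw [Finset.sum_comm]
    simp only [← mul_assoc, ← Finset.sum_mul, mul_sub, Finset.sum_sub_distrib, hc0, zero_mul,
      zero_sub]
    have hi : ∀ i, ∑ a ∈ K, c a * a i = -e i := by
      intro i
      have := congrArg (fun v : E d => v i) hce
      simpa using this
    simp [hi, e]
  have hn : ∀ a (ha : a ∈ K), outNormal K (K.erase a) j = c a * hK.height hd ha := by
    intro a ha
    have h1 : outNormal K (K.erase a) j = inner ℝ (unitNormal K (K.erase a)) ((e - a) - (0 - a)) := by
      rw [sub_sub_sub_cancel_right, inner_unitNormal]; simp [e]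
    rw [h1, inner_sub_right, hK.inner_unitNormal_sub hd ha, hK.inner_unitNormal_sub hd ha]
    simp only [c]; ring
  simp only [hpt]
  rw [hK.sum_faces, integral_finsetSum]
  · refine Finset.sum_congr rfl fun a ha => ?_
    rw [integral_const_mul, hull_eq_cone ha (hK.erase_nonempty hd ha),
      integral_cone_div hd (hK.unitNormal_spec hd ha).1 a (hK.height_pos hd ha)
        (isCompact_hull _) (fun x hx => hK.inner_face hd ha hx), surfInt, integral_mul_const, hn a ha]
    ring
  · intro a _
    exact ContinuousOn.integrableOn_compact (isCompact_hull _)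
      (Continuous.continuousOn (by fun_prop))

end IsSimplex

open Classical in
/-- On a common face the outward normals of two elements are opposite: otherwise both elements
would lie on the same side, and would share more than the face. -/
theorem outNormal_eq_neg {d : ℕ} (hd : 0 < d) {K L F : Finset (E d)} (hK : IsSimplex K)
    (hL : IsSimplex L) (hKL : K ≠ L) (hconf : hull K ∩ hull L = hull (K ∩ L))
    (hFK : F ∈ K.powersetCard d) (hFL : F ∈ L.powersetCard d) :
    outNormal L F = - outNormal K F := by
  obtain ⟨a, ha, rfl⟩ := hK.exists_eq_erase hFK
  obtain ⟨b, hb, hba⟩ := hL.exists_eq_erase hFL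
  have hinter : K ∩ L = K.erase a := by
    have hsub : K.erase a ⊆ K ∩ L := Finset.subset_inter (Finset.erase_subset _ _)
      (hba ▸ Finset.erase_subset _ _)
    refine (Finset.eq_of_subset_of_card_le hsub ?_).symm
    rw [Finset.card_erase_of_mem ha, hK.card_eq, Nat.add_sub_cancel]
    by_contra! hlt
    have h1 := Finset.eq_of_subset_of_card_le (Finset.inter_subset_left (s₁ := K) (s₂ := L))
      (by rw [hK.card_eq]; omega)
    have h2 := Finset.eq_of_subset_of_card_le (Finset.inter_subset_right (s₁ := K) (s₂ := L))
      (by rw [hL.card_eq]; omega)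
    exact hKL (h1.symm.trans h2)
  have hn := hK.unitNormal_spec hd ha
  have hn' := hL.unitNormal_spec hd hb
  rw [hba] at hn'
  set n := unitNormal K (K.erase a) with hndef
  set n' := unitNormal L (K.erase a) with hndef'
  obtain ⟨y, hy⟩ := hK.erase_nonempty hd ha
  have hyK : y ∈ K := Finset.mem_of_mem_erase hy
  have hx := hK.inner_sub_eq_coord_mul ha (fun x hx => hn.2.1 x hx y hy)
  have hx' := hK.inner_sub_eq_coord_mul ha (fun x hx => hn'.2.1 x hx y hy)
  have hneg : ∀ {m : E d}, ‖m‖ = 1 →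
      (∀ x, inner ℝ m (x - y) = hK.coord a x * inner ℝ m (a - y)) → inner ℝ m (a - y) ≠ 0 := by
    intro m hm h h0
    have := h (y + m)
    simp [h0, hm] at this
  have h0 := hneg hn.1 hx
  have h0' := hneg hn'.1 hx'
  have hlt : inner ℝ n (a - y) < 0 := lt_of_le_of_ne (hn.2.2 a ha y hy) h0
  -- both normals are multiples of the gradient of the same barycentric coordinate
  obtain ⟨l, hl⟩ : ∃ l : ℝ, n' = l • n := by
    refine ⟨inner ℝ n' (a - y) / inner ℝ n (a - y), ext_inner_right ℝ fun v => ?_⟩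
    have e1 := hx (y + v)
    have e2 := hx' (y + v)
    rw [add_sub_cancel_left] at e1 e2
    rw [inner_smul_left, e1, e2]
    simp only [conj_trivial]
    field_simp
  have habs : |l| = 1 := by
    have := hn'.1
    rwa [hl, norm_smul, hn.1, mul_one, Real.norm_eq_abs] at this
  have hl1 : l = -1 := by
    rcases eq_or_eq_neg_of_abs_eq habs with h | h
    swap
    · exact h
    exfalso
    rw [h, one_smul] at hl
    rw [hl] at hn'
    -- the vertex `b` of `L` lies on the same side of the face as `K`
    have hbne : inner ℝ n (b - y) ≠ 0 := by
      have hyL : y ∈ L := Finset.mem_of_mem_erase (hba ▸ hy)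
      intro hb0
      have := hL.inner_sub_eq_coord_mul hb (n := n) (y := y)
        (fun x hx => hn.2.1 x (hba ▸ hx) y hy) (y + n)
      simp [hb0, hn.1] at this
    have hblt : inner ℝ n (b - y) < 0 := lt_of_le_of_ne (hn'.2.2 b hb y hy) hbne
    have hcb : 0 < hK.coord a b := by
      have := hx b
      by_contra! hle
      nlinarith
    -- move from the barycenter `x₀` of the face a little towards `b`
    let x₀ : E d := ∑ v ∈ K.erase a, (d : ℝ)⁻¹ • v
    have hcard : (K.erase a).card = d := by
      rw [Finset.card_erase_of_mem ha, hK.card_eq, Nat.add_sub_cancel]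
    have hd0 : (d : ℝ) ≠ 0 := by positivity
    have hx₀F : x₀ ∈ hull (K.erase a) :=
      (convex_convexHull ℝ _).sum_mem (fun _ _ => by positivity) (by simp [hcard, hd0])
        fun v hv => subset_convexHull ℝ _ hv
    have hx₀L : x₀ ∈ hull L := convexHull_mono (by
      rw [← hba]; exact_mod_cast Finset.erase_subset _ _) hx₀F
    have hx₀n : inner ℝ n (x₀ - y) = 0 :=
      inner_eq_of_mem_hull (fun x hx => hn.2.1 x hx y hy) hx₀F
    have hcoord₀ : ∀ v ∈ K, v ≠ a → 0 < hK.coord v x₀ := by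
      intro v hv hva
      have hv' : v ∈ K.erase a := Finset.mem_erase.2 ⟨hva, hv⟩
      rw [hK.coord_sum (by simp [hcard, hd0]), Finset.sum_eq_single v, hK.coord_self hv]
      · positivity
      · intro u hu huv
        rw [hK.coord_ne (Finset.mem_of_mem_erase hu) huv.symm, mul_zero]
      · exact fun h => absurd hv' h
    have hcoord₀a : hK.coord a x₀ = 0 := by
      have := hx x₀
      rw [hx₀n] at this
      exact (mul_eq_zero.1 this.symm).resolve_right h0
    have hev : ∀ v ∈ K, ∀ᶠ ε : ℝ in nhdsWithin 0 (Ioi 0),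
        0 ≤ hK.coord v (AffineMap.lineMap x₀ b ε) := by
      intro v hv
      rcases eq_or_ne v a with rfl | hva
      · filter_upwards [self_mem_nhdsWithin] with ε hε
        rw [AffineMap.apply_lineMap, hcoord₀a]
        simp only [AffineMap.lineMap_apply, vsub_eq_sub, smul_eq_mul, vadd_eq_add, sub_zero,
          add_zero]
        exact mul_nonneg (le_of_lt hε) hcb.le
      · have hcont : Continuous fun ε : ℝ => hK.coord v (AffineMap.lineMap x₀ b ε) := by
          simp only [AffineMap.apply_lineMap]
          exact AffineMap.lineMap_continuous
        have hpos : 0 < hK.coord v (AffineMap.lineMap x₀ b (0 : ℝ)) := by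
          simpa using hcoord₀ v hv hva
        exact (Filter.Eventually.filter_mono nhdsWithin_le_nhds
          (hcont.continuousAt.eventually (lt_mem_nhds hpos))).mono fun _ h => le_of_lt h
    have hev1 : ∀ᶠ ε : ℝ in nhdsWithin 0 (Ioi 0), ε < 1 :=
      Filter.Eventually.filter_mono nhdsWithin_le_nhds (gt_mem_nhds one_pos)
    have hev0 : ∀ᶠ ε : ℝ in nhdsWithin 0 (Ioi 0), 0 < ε := self_mem_nhdsWithin
    obtain ⟨ε, hε, hε1, hε0⟩ := (((Finset.eventually_all K).2 hev).and (hev1.and hev0)).exists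
    have hzK : AffineMap.lineMap x₀ b ε ∈ hull K := hK.mem_hull hε
    have hzL : AffineMap.lineMap x₀ b ε ∈ hull L :=
      (convex_convexHull ℝ _).lineMap_mem hx₀L (subset_convexHull ℝ _ hb) ⟨hε0.le, hε1.le⟩
    have hz : AffineMap.lineMap x₀ b ε ∈ hull (K.erase a) := by
      rw [← hinter, ← hconf]; exact ⟨hzK, hzL⟩
    have hz0 := inner_eq_of_mem_hull (fun x hx => hn.2.1 x hx y hy) hz
    have hz1 : AffineMap.lineMap x₀ b ε - y = (1 - ε) • (x₀ - y) + ε • (b - y) := by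
      rw [AffineMap.lineMap_apply_module]; module
    rw [hz1, inner_add_right, inner_smul_right, inner_smul_right, hx₀n] at hz0
    nlinarith
  ext i
  have := congrArg (fun v : E d => v i) hl
  simpa [hl1, hndef, hndef', unitNormal] using this

/-! ### Regrouping integrals face by face -/

namespace Mesh

variable {d : ℕ} {Ω : Set (E d)} (M : Mesh Ω)

open Classical in
theorem mem_faces_iff {F : Finset (E d)} :
    F ∈ M.faces ↔ ∃ K ∈ M.elems, F ∈ K.powersetCard d := by
  simp only [faces, Finset.mem_biUnion]

open Classical in
theorem filter_eq {F : Finset (E d)} (hF : F ∈ M.faces) :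
    M.elems.filter (fun L => F ⊆ L) = {M.plus F, M.minus F} := by
  obtain ⟨K, hK, hFK⟩ := M.mem_faces_iff.1 hF
  exact M.adjacent K hK F hFK

theorem card_of_mem_faces {F : Finset (E d)} (hF : F ∈ M.faces) : F.card = d := by
  obtain ⟨K, -, hFK⟩ := M.mem_faces_iff.1 hF
  exact (Finset.mem_powersetCard.1 hFK).2

theorem plus_mem {F : Finset (E d)} (hF : F ∈ M.faces) :
    M.plus F ∈ M.elems ∧ F ∈ (M.plus F).powersetCard d := by
  classical
  have h : M.plus F ∈ M.elems.filter (fun L => F ⊆ L) := by rw [M.filter_eq hF]; simp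
  rw [Finset.mem_filter] at h
  exact ⟨h.1, Finset.mem_powersetCard.2 ⟨h.2, M.card_of_mem_faces hF⟩⟩

theorem minus_mem {F : Finset (E d)} (hF : F ∈ M.faces) :
    M.minus F ∈ M.elems ∧ F ∈ (M.minus F).powersetCard d := by
  classical
  have h : M.minus F ∈ M.elems.filter (fun L => F ⊆ L) := by rw [M.filter_eq hF]; simp
  rw [Finset.mem_filter] at h
  exact ⟨h.1, Finset.mem_powersetCard.2 ⟨h.2, M.card_of_mem_faces hF⟩⟩

theorem numElems_eq {F : Finset (E d)} (hF : F ∈ M.faces) [Decidable (M.plus F = M.minus F)] :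
    M.numElems F = if M.plus F = M.minus F then 1 else 2 := by
  classical
  rw [numElems, M.filter_eq hF]
  split_ifs with h
  · simp [h]
  · exact Finset.card_pair h

theorem isInterior_iff {F : Finset (E d)} :
    M.IsInterior F ↔ F ∈ M.faces ∧ M.plus F ≠ M.minus F := by
  classical
  refine and_congr_right fun hF => ?_
  rw [M.numElems_eq hF]; split_ifs with h <;> simp [h]

theorem isBoundary_iff {F : Finset (E d)} :
    M.IsBoundary F ↔ F ∈ M.faces ∧ M.plus F = M.minus F := by
  classical
  refine and_congr_right fun hF => ?_
  rw [M.numElems_eq hF]; split_ifs with h <;> simp [h]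

variable {M}

theorem IsBoundary.not_isInterior {F : Finset (E d)} (hF : M.IsBoundary F) : ¬ M.IsInterior F :=
  fun h => (M.isInterior_iff.1 h).2 (M.isBoundary_iff.1 hF).2

theorem IsInterior.not_isBoundary {F : Finset (E d)} (hF : M.IsInterior F) : ¬ M.IsBoundary F :=
  fun h => h.not_isInterior hF

theorem IsInterior.outNormal_minus (hd : 0 < d) {F : Finset (E d)} (hF : M.IsInterior F) :
    outNormal (M.minus F) F = - M.normal F := by
  classical
  obtain ⟨hp, hFp⟩ := M.plus_mem hF.1
  obtain ⟨hm, hFm⟩ := M.minus_mem hF.1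
  refine outNormal_eq_neg hd (M.isSimplex hp) (M.isSimplex hm) (M.isInterior_iff.1 hF).2 ?_ hFp hFm
  convert! M.conforming _ hp _ hm

variable (M)

theorem normal_dotProduct_self (hd : 0 < d) {F : Finset (E d)} (hF : F ∈ M.faces) :
    M.normal F ⬝ᵥ M.normal F = 1 := by
  classical
  obtain ⟨hp, hFp⟩ := M.plus_mem hF
  obtain ⟨a, ha, haF⟩ := (M.isSimplex hp).exists_eq_erase hFp
  have h := ((M.isSimplex hp).unitNormal_spec hd ha).1
  rw [haF] at h
  have h2 := inner_unitNormal (M.plus F) F (unitNormal (M.plus F) F)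
  rw [real_inner_self_eq_norm_sq, h] at h2
  simpa [unitNormal, normal] using h2.symm

theorem integrableOn_face (hd : 0 < d) {K F : Finset (E d)} (hK : K ∈ M.elems)
    (hF : F ∈ K.powersetCard d) {g : E d → ℝ} (hg : Continuous g) :
    IntegrableOn g (hull F) (Measure.euclideanHausdorffMeasure (d - 1)) := by
  classical
  obtain ⟨a, ha, rfl⟩ := (M.isSimplex hK).exists_eq_erase hF
  exact (M.isSimplex hK).integrableOn_face hd ha hg

theorem integrableOn_hull (K : Finset (E d)) {g : E d → ℝ} (hg : Continuous g) :
    IntegrableOn g (hull K) :=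
  hg.continuousOn.integrableOn_compact (isCompact_hull K)

theorem bdrySum_add (hd : 0 < d) {g g' : Finset (E d) → Finset (E d) → E d → ℝ}
    (hg : ∀ K F, Continuous (g K F)) (hg' : ∀ K F, Continuous (g' K F)) :
    M.bdrySum (fun K F x => g K F x + g' K F x) = M.bdrySum g + M.bdrySum g' := by
  simp only [bdrySum, ← Finset.sum_add_distrib]
  refine Finset.sum_congr rfl fun K hK => Finset.sum_congr rfl fun F hF => ?_
  exact integral_add (M.integrableOn_face hd hK hF (hg K F)) (M.integrableOn_face hd hK hF (hg' K F))

theorem bdrySum_const_mul (c : ℝ) (g : Finset (E d) → Finset (E d) → E d → ℝ) :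
    M.bdrySum (fun K F x => c * g K F x) = c * M.bdrySum g := by
  simp only [bdrySum, Finset.mul_sum, surfInt, integral_const_mul]

theorem bdrySum_neg_add_sub_add (hd : 0 < d) {g₁ g₂ g₃ g₄ : Finset (E d) → Finset (E d) → E d → ℝ}
    (h₁ : ∀ K F, Continuous (g₁ K F)) (h₂ : ∀ K F, Continuous (g₂ K F))
    (h₃ : ∀ K F, Continuous (g₃ K F)) (h₄ : ∀ K F, Continuous (g₄ K F)) :
    M.bdrySum (fun K F x => -g₁ K F x + g₂ K F x - g₃ K F x + g₄ K F x) =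
      -M.bdrySum g₁ + M.bdrySum g₂ - M.bdrySum g₃ + M.bdrySum g₄ := by
  have h12 : ∀ K F, Continuous fun x => (-1) * g₁ K F x + g₂ K F x :=
    fun K F => ((h₁ K F).const_mul _).add (h₂ K F)
  have h123 : ∀ K F, Continuous fun x => (-1) * g₁ K F x + g₂ K F x + (-1) * g₃ K F x :=
    fun K F => (h12 K F).add ((h₃ K F).const_mul _)
  have e : ∀ K F x, -g₁ K F x + g₂ K F x - g₃ K F x + g₄ K F x =
      (-1) * g₁ K F x + g₂ K F x + (-1) * g₃ K F x + g₄ K F x := fun K F x => by ring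
  simp only [e]
  rw [M.bdrySum_add hd h123 h₄, M.bdrySum_add hd h12 fun K F => (h₃ K F).const_mul _,
    M.bdrySum_add hd (fun K F => (h₁ K F).const_mul _) h₂, M.bdrySum_const_mul,
    M.bdrySum_const_mul]
  ring

open Classical in
theorem intBdrySum_eq (g : Finset (E d) → Finset (E d) → E d → ℝ) :
    M.intBdrySum g = M.bdrySum (fun K F x => if M.IsInterior F then g K F x else 0) := by
  simp only [bdrySum, intBdrySum, Finset.sum_filter]
  refine Finset.sum_congr rfl fun K hK => Finset.sum_congr rfl fun F hF => ?_
  split_ifs <;> simp [surfInt]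

open Classical in
theorem outerBdrySum_eq (g : Finset (E d) → Finset (E d) → E d → ℝ) :
    M.outerBdrySum g = M.bdrySum (fun K F x => if M.IsBoundary F then g K F x else 0) := by
  simp only [bdrySum, outerBdrySum, Finset.sum_filter]
  refine Finset.sum_congr rfl fun K hK => Finset.sum_congr rfl fun F hF => ?_
  split_ifs <;> simp [surfInt]

/-- A sum of integrals over element boundaries is regrouped face by face: an interior face collects
the contributions of its two elements, a boundary face that of its single element. -/
theorem bdrySum_nonneg (hd : 0 < d) {g : Finset (E d) → Finset (E d) → E d → ℝ}
    (hg : ∀ K F, Continuous (g K F))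
    (hint : ∀ F, M.IsInterior F → ∀ x, 0 ≤ g (M.plus F) F x + g (M.minus F) F x)
    (hbd : ∀ F, M.IsBoundary F → ∀ x, 0 ≤ g (M.plus F) F x) : 0 ≤ M.bdrySum g := by
  classical
  have h : M.bdrySum g = ∑ F ∈ M.faces, ∑ K ∈ M.elems.filter (fun L => F ⊆ L),
      surfInt F (g K F) := by
    refine Finset.sum_comm' fun K F => ?_
    simp only [Finset.mem_filter, Finset.mem_powersetCard]
    constructor
    · rintro ⟨hK, hFK, hF⟩
      exact ⟨⟨hK, hFK⟩, M.mem_faces_iff.2 ⟨K, hK, Finset.mem_powersetCard.2 ⟨hFK, hF⟩⟩⟩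
    · rintro ⟨⟨hK, hFK⟩, hF⟩
      exact ⟨hK, hFK, M.card_of_mem_faces hF⟩
  rw [h]
  refine Finset.sum_nonneg fun F hF => ?_
  rw [M.filter_eq hF]
  obtain ⟨hp, hFp⟩ := M.plus_mem hF
  obtain ⟨hm, hFm⟩ := M.minus_mem hF
  by_cases hpm : M.plus F = M.minus F
  · have hb := M.isBoundary_iff.2 ⟨hF, hpm⟩
    rw [← hpm, Finset.pair_eq_singleton, Finset.sum_singleton]
    exact integral_nonneg fun x => hbd F hb x
  · have hi := M.isInterior_iff.2 ⟨hF, hpm⟩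
    rw [Finset.sum_pair hpm, surfInt, surfInt,
      ← integral_add (M.integrableOn_face hd hp hFp (hg _ F))
        (M.integrableOn_face hd hm hFm (hg _ F))]
    exact integral_nonneg fun x => hint F hi x

/-- The divergence theorem for broken polynomial fields. -/
theorem elemSum_div (hd : 0 < d) (q : VecField d) :
    M.elemSum q.div = M.bdrySum (fun K F x => q.val K x ⬝ᵥ outNormal K F) := by
  have hc := continuous_eval_ofLp (d := d)
  refine Finset.sum_congr rfl fun K hK => ?_
  simp only [VecField.div, VecField.grad, Matrix.trace, Matrix.diag_apply, Matrix.of_apply,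
    surfInt, dotProduct, VecField.val]
  rw [integral_finsetSum _ fun j _ => integrableOn_hull K (hc _)]
  simp only [(M.isSimplex hK).integral_pderiv hd]
  rw [Finset.sum_comm]
  refine Finset.sum_congr rfl fun F hF => ?_
  exact (integral_finsetSum _ fun j _ =>
    M.integrableOn_face hd hK hF ((hc _).mul continuous_const)).symm

variable {M}

section Traces

variable {α : Type} [AddCommGroup α]

theorem IsInterior.jump_eq {F : Finset (E d)} (hF : M.IsInterior F) (φ : Finset (E d) → E d → α)
    (x : E d) : M.jump φ F x = φ (M.plus F) x - φ (M.minus F) x := if_pos hF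

theorem IsBoundary.jump_eq {F : Finset (E d)} (hF : M.IsBoundary F) (φ : Finset (E d) → E d → α)
    (x : E d) : M.jump φ F x = φ (M.plus F) x := if_neg hF.not_isInterior

theorem IsInterior.avg_eq [Module ℝ α] {F : Finset (E d)} (hF : M.IsInterior F)
    (φ : Finset (E d) → E d → α) (x : E d) :
    M.avg φ F x = (1 / 2 : ℝ) • (φ (M.plus F) x + φ (M.minus F) x) := if_pos hF

theorem IsBoundary.avg_eq [Module ℝ α] {F : Finset (E d)} (hF : M.IsBoundary F)
    (φ : Finset (E d) → E d → α) (x : E d) : M.avg φ F x = φ (M.plus F) x :=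
  if_neg hF.not_isInterior

variable [TopologicalSpace α] [IsTopologicalAddGroup α]

variable (M) in
theorem continuous_jump {φ : Finset (E d) → E d → α} (hφ : ∀ K, Continuous (φ K))
    (F : Finset (E d)) : Continuous (M.jump φ F) := by
  unfold jump
  split_ifs
  · exact (hφ _).sub (hφ _)
  · exact hφ _

variable (M) in
theorem continuous_avg [Module ℝ α] [ContinuousConstSMul ℝ α] {φ : Finset (E d) → E d → α}
    (hφ : ∀ K, Continuous (φ K)) (F : Finset (E d)) : Continuous (M.avg φ F) := by
  unfold avg
  split_ifs
  · exact ((hφ _).add (hφ _)).const_smul _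
  · exact hφ _

end Traces

end Mesh

theorem VecField.continuous_val {d : ℕ} (v : VecField d) (K : Finset (E d)) :
    Continuous (v.val K) :=
  continuous_pi fun _ => continuous_eval_ofLp _

theorem VecField.continuous_grad {d : ℕ} (v : VecField d) (K : Finset (E d)) :
    Continuous (v.grad K) :=
  continuous_matrix fun _ _ => continuous_eval_ofLp _

theorem VecField.continuous_stress {d : ℕ} (κ : StressKind) (v : VecField d) (K : Finset (E d)) :
    Continuous (v.stress κ K) := by
  have h := v.continuous_grad K
  cases κ
  · exact h
  · exact h.add h.matrix_transpose
  · exact (h.add h.matrix_transpose).sub ((h.matrix_trace.const_mul _).smul continuous_const)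

theorem continuous_frob {d : ℕ} {A B : E d → Matrix (Fin d) (Fin d) ℝ} (hA : Continuous A)
    (hB : Continuous B) : Continuous fun x => frob (A x) (B x) :=
  continuous_finsetSum _ fun i _ => continuous_finsetSum _ fun j _ =>
    (hA.matrix_elem i j).mul (hB.matrix_elem i j)

theorem Mesh.continuous_jumpTensor {d : ℕ} {Ω : Set (E d)} (M : Mesh Ω) (v : VecField d)
    (F : Finset (E d)) : Continuous (M.jumpTensor v.val F) :=
  M.continuous_jump (fun K => (v.continuous_val K).matrix_vecMulVec continuous_const) F

/-! ### Convection -/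

/-- The field `|u|² u`, whose divergence is twice the volume integrand of the convective form. -/
noncomputable def energyFlux {d : ℕ} (u : VecField d) : VecField d :=
  fun K j => u K j * ∑ i, u K i ^ 2

theorem val_energyFlux {d : ℕ} (u : VecField d) (K : Finset (E d)) (x : E d) :
    (energyFlux u).val K x = (u.val K x ⬝ᵥ u.val K x) • u.val K x := by
  ext j
  simp [energyFlux, VecField.val, dotProduct, mul_comm, sq]

theorem div_energyFlux {d : ℕ} (u : VecField d) (K : Finset (E d)) (x : E d) :
    (energyFlux u).div K x =
      2 * frob (Matrix.vecMulVec (u.val K x) (u.val K x)) (u.grad K x) +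
        u.div K x * (u.val K x ⬝ᵥ u.val K x) := by
  have hj : ∀ j, MvPolynomial.eval x.ofLp (MvPolynomial.pderiv j (energyFlux u K j)) =
      u.grad K x j j * (u.val K x ⬝ᵥ u.val K x) +
        ∑ i, 2 * (u.val K x i * u.val K x j * u.grad K x i j) := by
    intro j
    have hs : MvPolynomial.pderiv j (∑ i, u K i ^ 2) =
        ∑ i, 2 * u K i * MvPolynomial.pderiv j (u K i) := by
      rw [map_sum]
      exact Finset.sum_congr rfl fun i _ => by rw [MvPolynomial.pderiv_pow]; simp
    rw [energyFlux, MvPolynomial.pderiv_mul, hs, Finset.mul_sum]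
    simp only [map_add, map_mul, map_sum, map_pow, map_ofNat, VecField.grad, Matrix.of_apply,
      VecField.val, dotProduct, ← sq]
    congr 1
    · rw [Finset.mul_sum]
    · rw [Finset.mul_sum]
      exact Finset.sum_congr rfl fun i _ => by ring
  have h : (energyFlux u).div K x = ∑ j, (u.grad K x j j * (u.val K x ⬝ᵥ u.val K x) +
      ∑ i, 2 * (u.val K x i * u.val K x j * u.grad K x i j)) := by
    rw [VecField.div, Matrix.trace]
    exact Finset.sum_congr rfl fun j _ => hj j
  rw [h, Finset.sum_add_distrib, Finset.sum_comm, ← Finset.sum_mul, add_comm]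
  simp only [frob, Finset.mul_sum]
  rfl

theorem real_dotProduct_self_nonneg {d : ℕ} (v : Fin d → ℝ) : 0 ≤ v ⬝ᵥ v :=
  Finset.sum_nonneg fun _ _ => mul_self_nonneg _

/-- The identities behind the convective form on an interior face: the central flux and the
averaged correction cancel the flux of kinetic energy. -/
theorem convection_interior_nonneg {d : ℕ} (p q n : Fin d → ℝ) (hn : n ⬝ᵥ n = 1) {s : ℝ}
    (hs : 0 ≤ s) :
    0 ≤ (-(1 / 2) * ((p ⬝ᵥ p) • p ⬝ᵥ n)
      + ((s • (Matrix.vecMulVec p n - Matrix.vecMulVec q n)) *ᵥ n) ⬝ᵥ p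
      + (Matrix.vecMulVec ((1 / 2 : ℝ) • (p + q)) ((1 / 2 : ℝ) • (p + q)) *ᵥ n) ⬝ᵥ p
      + 1 / 2 * (p ⬝ᵥ (((1 / 2 : ℝ) • (p ⬝ᵥ p + q ⬝ᵥ q)) • n)))
      + (-(1 / 2) * ((q ⬝ᵥ q) • q ⬝ᵥ -n)
      + ((s • (Matrix.vecMulVec p n - Matrix.vecMulVec q n)) *ᵥ -n) ⬝ᵥ q
      + (Matrix.vecMulVec ((1 / 2 : ℝ) • (p + q)) ((1 / 2 : ℝ) • (p + q)) *ᵥ -n) ⬝ᵥ q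
      + 1 / 2 * (q ⬝ᵥ (((1 / 2 : ℝ) • (p ⬝ᵥ p + q ⬝ᵥ q)) • -n))) := by
  have h0 : 0 ≤ (p - q) ⬝ᵥ (p - q) := real_dotProduct_self_nonneg _
  have h1 := mul_nonneg hs h0
  refine h1.trans_eq ?_
  simp only [Matrix.smul_mulVec, Matrix.sub_mulVec, Matrix.vecMulVec_mulVec, Matrix.mulVec_neg,
    smul_dotProduct, dotProduct_smul, sub_dotProduct, dotProduct_sub, neg_dotProduct,
    dotProduct_neg, add_dotProduct, smul_eq_mul, op_smul_eq_smul, hn,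
    dotProduct_comm q p]
  ring

theorem convection_boundary_nonneg {d : ℕ} (p n : Fin d → ℝ) (hn : n ⬝ᵥ n = 1) {ζ : ℝ}
    (hζ : 1 / 2 ≤ ζ) :
    0 ≤ -(1 / 2) * ((p ⬝ᵥ p) • p ⬝ᵥ n)
      + (((ζ * |p ⬝ᵥ n|) • (Matrix.vecMulVec p n)) *ᵥ n) ⬝ᵥ p
      + (Matrix.vecMulVec p p *ᵥ n) ⬝ᵥ p := by
  have h0 : 0 ≤ p ⬝ᵥ p := real_dotProduct_self_nonneg _
  simp only [Matrix.smul_mulVec, Matrix.vecMulVec_mulVec, smul_dotProduct, smul_eq_mul,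
    op_smul_eq_smul, hn]
  have h1 : 0 ≤ 1 / 2 * (p ⬝ᵥ n) + ζ * |p ⬝ᵥ n| := by
    have := neg_abs_le (p ⬝ᵥ n)
    nlinarith [abs_nonneg (p ⬝ᵥ n)]
  nlinarith [mul_nonneg h1 h0]

theorem dotProduct_self_continuous {d : ℕ} (u : VecField d) (K : Finset (E d)) :
    Continuous fun x => u.val K x ⬝ᵥ u.val K x :=
  (u.continuous_val K).dotProduct (u.continuous_val K)

/-- The convective form is nonnegative on the diagonal. -/
theorem Mesh.formC_nonneg {d : ℕ} (hd : 0 < d) {Ω : Set (E d)} (M : Mesh Ω)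
    {ζ : Finset (E d) → ℝ} (hζ : ∀ F ∈ M.faces, 0 ≤ ζ F)
    (hζb : ∀ F, M.IsBoundary F → 1 / 2 ≤ ζ F) (u : VecField d) : 0 ≤ M.formC ζ u u u := by
  classical
  have hu := u.continuous_val
  have hG := u.continuous_grad
  have hvol : - M.elemSum (fun K x =>
        frob (Matrix.vecMulVec (u.val K x) (u.val K x)) (u.grad K x))
      - 1 / 2 * M.elemSum (fun K x => u.div K x * (u.val K x ⬝ᵥ u.val K x)) =
      M.bdrySum (fun K F x => -(1 / 2) * ((energyFlux u).val K x ⬝ᵥ outNormal K F)) := by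
    rw [M.bdrySum_const_mul, ← M.elemSum_div hd]
    have h : M.elemSum (energyFlux u).div =
        2 * M.elemSum (fun K x =>
          frob (Matrix.vecMulVec (u.val K x) (u.val K x)) (u.grad K x))
        + M.elemSum (fun K x => u.div K x * (u.val K x ⬝ᵥ u.val K x)) := by
      simp only [elemSum, Finset.mul_sum, ← Finset.sum_add_distrib]
      refine Finset.sum_congr rfl fun K hK => ?_
      rw [← integral_const_mul, ← integral_add]
      · simp only [div_energyFlux]
      · exact integrableOn_hull K
          ((continuous_frob ((hu K).matrix_vecMulVec (hu K)) (hG K)).const_mul 2)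
      · exact integrableOn_hull K ((hG K).matrix_trace.mul (dotProduct_self_continuous u K))
    rw [h]; ring
  have havg := M.continuous_avg hu
  have c1 : ∀ K F, Continuous fun x => -(1 / 2) * ((energyFlux u).val K x ⬝ᵥ outNormal K F) :=
    fun K F => (((energyFlux u).continuous_val K).dotProduct continuous_const).const_mul _
  have c2 : ∀ K F, Continuous fun x => (((ζ F * |M.avg u.val F x ⬝ᵥ M.normal F|) •
      M.jumpTensor u.val F x) *ᵥ outNormal K F) ⬝ᵥ u.val K x := fun K F =>
    (((((havg F).dotProduct continuous_const).abs.const_mul _).smul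
      (M.continuous_jumpTensor u F)).matrix_mulVec continuous_const).dotProduct (hu K)
  have c3 : ∀ K F, Continuous fun x => (Matrix.vecMulVec (M.avg u.val F x) (M.avg u.val F x)
      *ᵥ outNormal K F) ⬝ᵥ u.val K x := fun K F =>
    (((havg F).matrix_vecMulVec (havg F)).matrix_mulVec continuous_const).dotProduct (hu K)
  have c4 : ∀ K F, Continuous fun x => if M.IsInterior F then
      u.val K x ⬝ᵥ (M.avg (fun L y => u.val L y ⬝ᵥ u.val L y) F x • outNormal K F) else 0 := by
    intro K F
    split_ifs
    · exact (hu K).dotProduct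
        ((M.continuous_avg (dotProduct_self_continuous u) F).smul continuous_const)
    · exact continuous_const
  have c12 := fun K F => (c1 K F).add (c2 K F)
  have c123 := fun K F => (c12 K F).add (c3 K F)
  have c4' := fun K F => (c4 K F).const_mul (1 / 2)
  rw [formC, hvol, M.intBdrySum_eq, ← M.bdrySum_const_mul, ← M.bdrySum_add hd,
    ← M.bdrySum_add hd, ← M.bdrySum_add hd]
  rotate_left
  · exact c123
  · exact c4'
  · exact c12
  · exact c3
  · exact c1
  · exact c2
  refine M.bdrySum_nonneg hd (fun K F => (c123 K F).add (c4' K F)) ?_ ?_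
  · intro F hF x
    have hp : outNormal (M.plus F) F = M.normal F := rfl
    simp only [if_pos hF, val_energyFlux, hF.avg_eq, jumpTensor, hF.jump_eq,
      hF.outNormal_minus hd, hp]
    exact convection_interior_nonneg _ _ _ (M.normal_dotProduct_self hd hF.1)
      (mul_nonneg (hζ F hF.1) (abs_nonneg _))
  · intro F hF x
    have hp : outNormal (M.plus F) F = M.normal F := rfl
    simp only [if_neg hF.not_isInterior, val_energyFlux, hF.avg_eq, jumpTensor, hF.jump_eq, hp,
      mul_zero, add_zero]
    exact convection_boundary_nonneg _ _ (M.normal_dotProduct_self hd hF.1) (hζb F hF)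

/-! ### Viscosity -/

theorem totalDegree_pderiv_le {d : ℕ} (i : Fin d) (p : MvPolynomial (Fin d) ℝ) :
    (MvPolynomial.pderiv i p).totalDegree ≤ p.totalDegree := by
  refine Finset.sup_le fun m hm => ?_
  rw [MvPolynomial.mem_support_iff, MvPolynomial.coeff_pderiv] at hm
  have h := MvPolynomial.le_totalDegree (MvPolynomial.mem_support_iff.2 (left_ne_zero_of_mul hm))
  rw [Finsupp.sum_add_index' (fun _ => rfl) (fun _ _ _ => rfl)] at h
  omega

/-- The entries of the strain tensor are polynomials of degree at most `r`. -/
theorem exists_stress_poly {d r : ℕ} (κ : StressKind) (v : VecField d) (K : Finset (E d))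
    (hv : ∀ i, (v K i).totalDegree ≤ r) (i j : Fin d) :
    ∃ P : MvPolynomial (Fin d) ℝ, P.totalDegree ≤ r ∧
      ∀ x : E d, MvPolynomial.eval x.ofLp P = v.stress κ K x i j := by
  have hp : ∀ i j, (MvPolynomial.pderiv j (v K i)).totalDegree ≤ r := fun i j =>
    (totalDegree_pderiv_le _ _).trans (hv i)
  have hadd : ∀ {p q : MvPolynomial (Fin d) ℝ}, p.totalDegree ≤ r → q.totalDegree ≤ r →
      (p + q).totalDegree ≤ r := fun hp hq =>
    (MvPolynomial.totalDegree_add _ _).trans (max_le hp hq)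
  cases κ with
  | gradient => exact ⟨_, hp i j, fun x => rfl⟩
  | symmetric => exact ⟨_, hadd (hp i j) (hp j i), fun x => map_add _ _ _⟩
  | full =>
    refine ⟨MvPolynomial.pderiv j (v K i) + MvPolynomial.pderiv i (v K j) -
      MvPolynomial.C (2 / 3 * (1 : Matrix (Fin d) (Fin d) ℝ) i j) *
        ∑ k, MvPolynomial.pderiv k (v K k), ?_, fun x => ?_⟩
    · refine (MvPolynomial.totalDegree_sub _ _).trans (max_le (hadd (hp i j) (hp j i)) ?_)
      refine (MvPolynomial.totalDegree_mul _ _).trans ?_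
      rw [MvPolynomial.totalDegree_C, zero_add]
      exact MvPolynomial.totalDegree_finsetSum_le fun k _ => hp k k
    · simp [VecField.stress, StressKind.apply, VecField.grad, Matrix.trace]
      ring

theorem frob_self_nonneg {d : ℕ} (A : Matrix (Fin d) (Fin d) ℝ) : 0 ≤ frob A A :=
  Finset.sum_nonneg fun _ _ => Finset.sum_nonneg fun _ _ => mul_self_nonneg _

/-- Coercivity of the three strain tensors with respect to the strain itself. -/
theorem half_frob_stress_le {d : ℕ} (hd : d ≤ 3) (κ : StressKind)
    (G : Matrix (Fin d) (Fin d) ℝ) :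
    1 / 2 * frob (κ.apply G) (κ.apply G) ≤ frob (κ.apply G) G := by
  have hG : ∑ i, ∑ j, G j i * G j i = ∑ i, ∑ j, G i j * G i j := Finset.sum_comm
  have hG' : ∑ i, ∑ j, G j i * G i j = ∑ i, ∑ j, G i j * G j i := Finset.sum_comm
  cases κ with
  | gradient =>
    have := frob_self_nonneg G
    simp only [StressKind.apply]; linarith
  | symmetric =>
    refine le_of_eq ?_
    simp only [StressKind.apply, frob, Matrix.add_apply, Matrix.transpose_apply, add_mul, mul_add,
      Finset.sum_add_distrib, hG, hG']
    ring
  | full =>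
    have ht : ∑ i, G i i = G.trace := rfl
    have h3 : (d : ℝ) ≤ 3 := by exact_mod_cast hd
    have e1 : frob (StressKind.full.apply G) (StressKind.full.apply G) =
        2 * (∑ i, ∑ j, G i j * G i j) + 2 * (∑ i, ∑ j, G i j * G j i)
          - 8 / 3 * G.trace ^ 2 + 4 / 9 * d * G.trace ^ 2 := by
      simp only [StressKind.apply, frob, Matrix.add_apply, Matrix.sub_apply, Matrix.smul_apply,
        Matrix.one_apply, Matrix.transpose_apply, add_mul, mul_add, sub_mul, mul_sub,
        Finset.sum_add_distrib, Finset.sum_sub_distrib, hG, hG', smul_eq_mul, mul_ite, ite_mul,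
        mul_one, mul_zero, zero_mul, Finset.sum_ite_eq, Finset.mem_univ, if_true,
        ← Finset.mul_sum, ← Finset.sum_mul, ht, Finset.sum_const, Finset.card_univ,
        Fintype.card_fin, nsmul_eq_mul]
      ring
    have e2 : frob (StressKind.full.apply G) G =
        (∑ i, ∑ j, G i j * G i j) + (∑ i, ∑ j, G i j * G j i) - 2 / 3 * G.trace ^ 2 := by
      simp only [StressKind.apply, frob, Matrix.add_apply, Matrix.sub_apply, Matrix.smul_apply,
        Matrix.one_apply, Matrix.transpose_apply, add_mul, sub_mul,
        Finset.sum_add_distrib, Finset.sum_sub_distrib, hG', smul_eq_mul, mul_ite, ite_mul,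
        mul_one, mul_zero, zero_mul, Finset.sum_ite_eq, Finset.mem_univ, if_true,
        ← Finset.mul_sum, ht]
      ring
    rw [e1, e2]
    nlinarith [sq_nonneg G.trace, mul_nonneg (sub_nonneg.2 h3) (sq_nonneg G.trace)]

/-- Young's inequality for the traction `S n` against a vector. -/
theorem mulVec_dotProduct_le {d : ℕ} (S : Matrix (Fin d) (Fin d) ℝ) (n j : Fin d → ℝ)
    (hn : n ⬝ᵥ n = 1) {c : ℝ} (hc : 0 < c) :
    (S *ᵥ n) ⬝ᵥ j ≤ c * frob S S + 1 / (4 * c) * (j ⬝ᵥ j) := by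
  have h : 0 ≤ ∑ i, ∑ k, c * (S i k - j i * n k / (2 * c)) ^ 2 :=
    Finset.sum_nonneg fun _ _ => Finset.sum_nonneg fun _ _ => by positivity
  have e : ∑ i, ∑ k, c * (S i k - j i * n k / (2 * c)) ^ 2 =
      c * frob S S - (S *ᵥ n) ⬝ᵥ j + 1 / (4 * c) * (j ⬝ᵥ j) * (n ⬝ᵥ n) := by
    simp only [frob, Matrix.mulVec, dotProduct, Finset.mul_sum, Finset.sum_mul,
      ← Finset.sum_sub_distrib]
    rw [Finset.sum_comm (f := fun i k => 1 / (4 * c) * (j k * j k) * (n i * n i))]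
    simp only [← Finset.sum_add_distrib]
    refine Finset.sum_congr rfl fun i _ => Finset.sum_congr rfl fun k _ => ?_
    field_simp
    ring
  rw [e, hn] at h
  linarith

/-- The viscous terms on an interior face add up to `-(S n + T n) · ⟦v⟧ + η |⟦v⟧|²`, which Young's
inequality bounds from below by the strain tensors `S`, `T` of the two elements. -/
theorem viscosity_interior_nonneg {d : ℕ} (S T : Matrix (Fin d) (Fin d) ℝ) (p q n : Fin d → ℝ)
    (hn : n ⬝ᵥ n = 1) {c η : ℝ} (hc : 0 < c) (hη : 1 / c ≤ η) :
    0 ≤ (-((((1 / 2 : ℝ) • (S + T) - η • (Matrix.vecMulVec p n - Matrix.vecMulVec q n)) *ᵥ n) ⬝ᵥ p)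
      + ((1 / 2 : ℝ) • (p + q) - p) ⬝ᵥ (S *ᵥ n) + c * frob S S)
      + (-((((1 / 2 : ℝ) • (S + T) - η • (Matrix.vecMulVec p n - Matrix.vecMulVec q n)) *ᵥ -n) ⬝ᵥ q)
      + ((1 / 2 : ℝ) • (p + q) - q) ⬝ᵥ (T *ᵥ -n) + c * frob T T) := by
  have h0 : 0 ≤ (p - q) ⬝ᵥ (p - q) := real_dotProduct_self_nonneg _
  have h1 := mulVec_dotProduct_le S n (p - q) hn hc
  have h2 := mulVec_dotProduct_le T n (p - q) hn hc
  have h3 : 1 / (4 * c) * ((p - q) ⬝ᵥ (p - q)) = 1 / 4 * (1 / c * ((p - q) ⬝ᵥ (p - q))) := by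
    field_simp
  have h4 := mul_le_mul_of_nonneg_right hη h0
  have h5 : 0 ≤ 1 / c * ((p - q) ⬝ᵥ (p - q)) := by positivity
  have h6 : 0 ≤ c * frob S S + c * frob T T - (S *ᵥ n) ⬝ᵥ (p - q) - (T *ᵥ n) ⬝ᵥ (p - q) +
      η * ((p - q) ⬝ᵥ (p - q)) := by linarith
  refine h6.trans_eq ?_
  simp only [Matrix.smul_mulVec, Matrix.sub_mulVec, Matrix.add_mulVec, Matrix.vecMulVec_mulVec,
    Matrix.mulVec_neg, smul_dotProduct, sub_dotProduct, dotProduct_sub, neg_dotProduct,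
    dotProduct_neg, add_dotProduct, smul_eq_mul, op_smul_eq_smul, hn, dotProduct_comm q p,
    dotProduct_comm p (S *ᵥ n), dotProduct_comm q (S *ᵥ n), dotProduct_comm p (T *ᵥ n),
    dotProduct_comm q (T *ᵥ n)]
  ring

theorem viscosity_boundary_nonneg {d : ℕ} (S : Matrix (Fin d) (Fin d) ℝ) (p n : Fin d → ℝ)
    (hn : n ⬝ᵥ n = 1) {c η : ℝ} (hc : 0 < c) (hη : 1 / c ≤ η) :
    0 ≤ -(((S - η • Matrix.vecMulVec p n) *ᵥ n) ⬝ᵥ p) - p ⬝ᵥ (S *ᵥ n) + c * frob S S := by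
  have h0 : 0 ≤ p ⬝ᵥ p := real_dotProduct_self_nonneg _
  -- the traction enters twice here, once for consistency and once for symmetry
  have h1 := mulVec_dotProduct_le S n p hn (half_pos hc)
  have h3 : 1 / (4 * (c / 2)) * (p ⬝ᵥ p) = 1 / 2 * (1 / c * (p ⬝ᵥ p)) := by
    field_simp; norm_num
  have h4 := mul_le_mul_of_nonneg_right hη h0
  simp only [Matrix.smul_mulVec, Matrix.sub_mulVec, Matrix.vecMulVec_mulVec,
    smul_dotProduct, sub_dotProduct, smul_eq_mul, op_smul_eq_smul, hn,
    dotProduct_comm p (S *ᵥ n)]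
  linarith

theorem hull_diam_pos {d : ℕ} (hd : 2 ≤ d) {F : Finset (E d)} (hF : F.card = d) :
    0 < Metric.diam (hull F) := by
  obtain ⟨x, hx, y, hy, hxy⟩ := Finset.one_lt_card.1 (by omega : 1 < F.card)
  exact (dist_pos.2 hxy).trans_le (Metric.dist_le_diam_of_mem (isCompact_hull F).isBounded
    (subset_convexHull ℝ _ hx) (subset_convexHull ℝ _ hy))

/-- The inverse trace inequality for the strain tensor on a shape-regular element. -/
theorem diam_mul_surfInt_stress_le {d r : ℕ} (hd : 0 < d) {σ C : ℝ} {K F : Finset (E d)}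
    (hK : IsSimplex K) (hF : F ∈ K.powersetCard d)
    (hσ : ∃ (c : E d) (ρ : ℝ), 0 < ρ ∧ Metric.closedBall c (ρ / 2) ⊆ hull K ∧
      Metric.diam (hull K) ≤ σ * ρ)
    (h1 : ∀ P : Polynomial ℝ, P.natDegree ≤ r →
      P.eval 1 ^ 2 ≤ C * ∫ t in (0 : ℝ)..1, t ^ (d - 1) * P.eval t ^ 2)
    (κ : StressKind) (v : VecField d) (hv : ∀ i, (v K i).totalDegree ≤ r) :
    Metric.diam (hull F) * surfInt F (fun x => frob (v.stress κ K x) (v.stress κ K x)) ≤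
      |σ| * C * ∫ x in hull K, frob (v.stress κ K x) (v.stress κ K x) := by
  classical
  obtain ⟨a, ha, rfl⟩ := hK.exists_eq_erase hF
  choose P hP hPe using exists_stress_poly κ v K hv
  have hc := continuous_eval_ofLp (d := d)
  have hint : ∀ x, frob (v.stress κ K x) (v.stress κ K x) =
      ∑ i, ∑ j, MvPolynomial.eval x.ofLp (P i j) ^ 2 := by
    intro x; simp only [hPe, frob, sq]
  have hH := hK.height_pos hd ha
  have htrace : hK.height hd ha *
      surfInt (K.erase a) (fun x => frob (v.stress κ K x) (v.stress κ K x)) ≤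
      C * ∫ x in hull K, frob (v.stress κ K x) (v.stress κ K x) := by
    have hcont : ∀ i j, Continuous fun x : E d => MvPolynomial.eval x.ofLp (P i j) ^ 2 :=
      fun i j => (hc _).pow 2
    simp only [hint, surfInt]
    rw [integral_finsetSum _ fun i _ => hK.integrableOn_face hd ha
        (continuous_finsetSum _ fun j _ => hcont i j),
      integral_finsetSum _ fun i _ => ContinuousOn.integrableOn_compact (isCompact_hull _)
        (continuous_finsetSum _ fun j _ => hcont i j).continuousOn, Finset.mul_sum, Finset.mul_sum]
    refine Finset.sum_le_sum fun i _ => ?_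
    rw [integral_finsetSum _ fun j _ => hK.integrableOn_face hd ha (hcont i j),
      integral_finsetSum _ fun j _ => ContinuousOn.integrableOn_compact (isCompact_hull _)
        (hcont i j).continuousOn, Finset.mul_sum, Finset.mul_sum]
    exact Finset.sum_le_sum fun j _ => hK.surfInt_sq_le hd ha h1 (hP i j)
  obtain ⟨c, ρ, hρ, hball, hdiam⟩ := hσ
  have hρH := hK.le_height hd ha hρ hball
  have hdF : Metric.diam (hull (K.erase a)) ≤ |σ| * hK.height hd ha :=
    calc Metric.diam (hull (K.erase a)) ≤ Metric.diam (hull K) :=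
          Metric.diam_mono (convexHull_mono (by exact_mod_cast Finset.erase_subset _ _))
            (isCompact_hull K).isBounded
      _ ≤ σ * ρ := hdiam
      _ ≤ |σ| * hK.height hd ha := by gcongr; exact le_abs_self σ
  have hs : 0 ≤ surfInt (K.erase a) (fun x => frob (v.stress κ K x) (v.stress κ K x)) :=
    integral_nonneg fun x => frob_self_nonneg _
  calc _ ≤ |σ| * hK.height hd ha *
        surfInt (K.erase a) (fun x => frob (v.stress κ K x) (v.stress κ K x)) := by gcongr
    _ = |σ| * (hK.height hd ha *
        surfInt (K.erase a) (fun x => frob (v.stress κ K x) (v.stress κ K x))) := by ring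
    _ ≤ |σ| * (C * ∫ x in hull K, frob (v.stress κ K x) (v.stress κ K x)) := by gcongr
    _ = _ := by ring

/-- The face terms of the viscous form are controlled from below by the strain tensor on the
faces, weighted by the face diameters. -/
theorem Mesh.viscous_faces_nonneg {d : ℕ} (hd : 2 ≤ d) {Ω : Set (E d)} (M : Mesh Ω)
    (κ : StressKind) {η : Finset (E d) → ℝ} {η₀ : ℝ} (hη₀ : 0 < η₀) (hη : ∀ F ∈ M.faces, η₀ ≤ η F)
    (v : VecField d) :
    0 ≤ - M.bdrySum (fun K F x =>
      ((M.avg (v.stress κ) F x - (η F * (Metric.diam (hull F))⁻¹) • M.jumpTensor v.val F x)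
        *ᵥ outNormal K F) ⬝ᵥ v.val K x)
      + M.intBdrySum (fun K F x =>
        (M.avg v.val F x - v.val K x) ⬝ᵥ (v.stress κ K x *ᵥ outNormal K F))
      - M.outerBdrySum (fun K F x => v.val K x ⬝ᵥ (v.stress κ K x *ᵥ outNormal K F))
      + M.bdrySum (fun K F x => Metric.diam (hull F) / η₀ *
        frob (v.stress κ K x) (v.stress κ K x)) := by
  classical
  have hd0 : 0 < d := by omega
  have hu := v.continuous_val
  have hτ := v.continuous_stress κ
  have c1 : ∀ K F, Continuous fun x =>
      ((M.avg (v.stress κ) F x - (η F * (Metric.diam (hull F))⁻¹) • M.jumpTensor v.val F x)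
        *ᵥ outNormal K F) ⬝ᵥ v.val K x := fun K F =>
    (((M.continuous_avg hτ F).fun_sub ((M.continuous_jumpTensor v F).fun_const_smul _)).matrix_mulVec
      continuous_const).dotProduct (hu K)
  have hSn : ∀ K F, Continuous fun x => v.stress κ K x *ᵥ outNormal K F := fun K F =>
    (hτ K).matrix_mulVec continuous_const
  have c2 : ∀ K F, Continuous fun x => if M.IsInterior F then
      (M.avg v.val F x - v.val K x) ⬝ᵥ (v.stress κ K x *ᵥ outNormal K F) else 0 := by
    intro K F
    split_ifs
    · exact ((M.continuous_avg hu F).sub (hu K)).dotProduct (hSn K F)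
    · exact continuous_const
  have c3 : ∀ K F, Continuous fun x => if M.IsBoundary F then
      v.val K x ⬝ᵥ (v.stress κ K x *ᵥ outNormal K F) else 0 := by
    intro K F
    split_ifs
    · exact (hu K).dotProduct (hSn K F)
    · exact continuous_const
  have c4 : ∀ K F : Finset (E d), Continuous fun x => Metric.diam (hull F) / η₀ *
      frob (v.stress κ K x) (v.stress κ K x) := fun K F =>
    (continuous_frob (hτ K) (hτ K)).const_mul _
  have hle : ∀ F ∈ M.faces,
      1 / (Metric.diam (hull F) / η₀) ≤ η F * (Metric.diam (hull F))⁻¹ := by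
    intro F hF
    have hh := hull_diam_pos hd (M.card_of_mem_faces hF)
    rw [one_div_div, div_eq_mul_inv]
    gcongr
    exact hη F hF
  rw [M.intBdrySum_eq, M.outerBdrySum_eq, ← M.bdrySum_neg_add_sub_add hd0 c1 c2 c3 c4]
  refine M.bdrySum_nonneg hd0
    (fun K F => (((c1 K F).neg.add (c2 K F)).sub (c3 K F)).add (c4 K F)) ?_ ?_
  · intro F hF x
    have hp : outNormal (M.plus F) F = M.normal F := rfl
    have hh := hull_diam_pos hd (M.card_of_mem_faces hF.1)
    simp only [if_pos hF, if_neg hF.not_isBoundary, hF.avg_eq, jumpTensor, hF.jump_eq,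
      hF.outNormal_minus hd0, hp, sub_zero]
    exact viscosity_interior_nonneg _ _ _ _ _ (M.normal_dotProduct_self hd0 hF.1)
      (div_pos hh hη₀) (hle F hF.1)
  · intro F hF x
    have hp : outNormal (M.plus F) F = M.normal F := rfl
    have hh := hull_diam_pos hd (M.card_of_mem_faces hF.1)
    simp only [if_pos hF, if_neg hF.not_isInterior, hF.avg_eq, jumpTensor, hF.jump_eq, hp,
      add_zero]
    exact viscosity_boundary_nonneg _ _ _ (M.normal_dotProduct_self hd0 hF.1)
      (div_pos hh hη₀) (hle F hF.1)

/-- The viscous form is nonnegative on the diagonal if the penalty parameter dominates the constant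
of the inverse trace inequality. -/
theorem Mesh.formA_nonneg {d r : ℕ} (hd : 2 ≤ d) (hd3 : d ≤ 3) {σ C : ℝ} {Ω : Set (E d)}
    (M : Mesh Ω) (hσ : M.ShapeRegular σ)
    (hC : 0 < C) (h1 : ∀ P : Polynomial ℝ, P.natDegree ≤ r →
      P.eval 1 ^ 2 ≤ C * ∫ t in (0 : ℝ)..1, t ^ (d - 1) * P.eval t ^ 2)
    (κ : StressKind) {η : Finset (E d) → ℝ}
    (hη : ∀ F ∈ M.faces, 2 * (d + 1) * ((|σ| + 1) * C) ≤ η F)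
    (v : VecField d) (hv : ∀ K ∈ M.elems, ∀ i, (v K i).totalDegree ≤ r) :
    0 ≤ M.formA κ η v v := by
  classical
  have hd0 : 0 < d := by omega
  have hG := v.continuous_grad
  have hτ := v.continuous_stress κ
  have hff : ∀ K, Continuous fun x => frob (v.stress κ K x) (v.stress κ K x) :=
    fun K => continuous_frob (hτ K) (hτ K)
  set η₀ : ℝ := 2 * (d + 1) * ((|σ| + 1) * C) with hη₀
  have hη₀pos : 0 < η₀ := by positivity
  set I : Finset (E d) → ℝ := fun K => ∫ x in hull K, frob (v.stress κ K x) (v.stress κ K x)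
    with hI
  have hI0 : ∀ K, 0 ≤ I K := fun K => integral_nonneg fun x => frob_self_nonneg _
  have hvol : 1 / 2 * ∑ K ∈ M.elems, I K ≤
      M.elemSum (fun K x => frob (v.stress κ K x) (v.grad K x)) := by
    rw [elemSum, Finset.mul_sum]
    refine Finset.sum_le_sum fun K hK => ?_
    rw [hI, ← integral_const_mul]
    exact setIntegral_mono (integrableOn_hull K ((hff K).const_mul _))
      (integrableOn_hull K (continuous_frob (hτ K) (hG K)))
      fun x => half_frob_stress_le hd3 κ (v.grad K x)
  have htr : M.bdrySum (fun K F x => Metric.diam (hull F) / η₀ *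
      frob (v.stress κ K x) (v.stress κ K x)) ≤ 1 / 2 * ∑ K ∈ M.elems, I K := by
    rw [bdrySum, Finset.mul_sum]
    refine Finset.sum_le_sum fun K hK => ?_
    -- each of the `d + 1` faces takes up the share `1 / (2 (d + 1))` of the volume term
    have hterm : ∀ F ∈ K.powersetCard d, surfInt F (fun x => Metric.diam (hull F) / η₀ *
        frob (v.stress κ K x) (v.stress κ K x)) ≤ (2 * (d + 1) : ℝ)⁻¹ * I K := by
      intro F hF
      have h := diam_mul_surfInt_stress_le hd0 (M.isSimplex hK) hF (hσ K hK) h1 κ v (hv K hK)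
      have h' : |σ| * C * I K ≤ (|σ| + 1) * C * I K := by
        have := mul_nonneg hC.le (hI0 K); nlinarith
      rw [surfInt, integral_const_mul, div_mul_eq_mul_div, div_le_iff₀ hη₀pos]
      refine (h.trans h').trans_eq ?_
      rw [hη₀]; field_simp
    refine (Finset.sum_le_card_nsmul _ _ _ hterm).trans_eq ?_
    rw [Finset.card_powersetCard, M.card_eq K hK, Nat.choose_succ_self_right, nsmul_eq_mul]
    push_cast
    field_simp
  have hfaces := M.viscous_faces_nonneg hd κ hη₀pos hη v
  rw [formA]
  linarith

/-! ### The energy argument in time -/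

section Energy

variable {X : Type*} [NormedAddCommGroup X]

/-- The regularization `√(‖x‖² + ε²)` of the norm, differentiable also at the zeros of a solution. -/
noncomputable def smoothNorm (ε : ℝ) (x : X) : ℝ := √(‖x‖ ^ 2 + ε ^ 2)

theorem norm_le_smoothNorm (ε : ℝ) (x : X) : ‖x‖ ≤ smoothNorm ε x :=
  Real.le_sqrt_of_sq_le (by nlinarith [sq_nonneg ε])

theorem smoothNorm_le {ε : ℝ} (hε : 0 ≤ ε) (x : X) : smoothNorm ε x ≤ ‖x‖ + ε :=
  Real.sqrt_le_iff.2 ⟨by positivity, by nlinarith [norm_nonneg x]⟩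

theorem smoothNorm_sub_le {ε : ℝ} (hε : 0 < ε) (x y : X) :
    smoothNorm ε x - smoothNorm ε y ≤ ‖x - y‖ := by
  have h1 : ‖x‖ ≤ ‖y‖ + ‖x - y‖ := by
    simpa [add_comm] using norm_add_le (x - y) y
  have hy := norm_le_smoothNorm ε y
  have hsq : smoothNorm ε y ^ 2 = ‖y‖ ^ 2 + ε ^ 2 := Real.sq_sqrt (by positivity)
  have hy0 : 0 ≤ smoothNorm ε y := Real.sqrt_nonneg _
  rw [sub_le_iff_le_add]
  refine Real.sqrt_le_iff.2 ⟨by positivity, ?_⟩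
  nlinarith [norm_nonneg x, norm_nonneg y, norm_nonneg (x - y),
    mul_le_mul_of_nonneg_right hy (norm_nonneg (x - y))]

theorem continuous_smoothNorm (ε : ℝ) : Continuous (smoothNorm ε : X → ℝ) := by
  unfold smoothNorm; fun_prop

theorem absolutelyContinuousOnInterval_smoothNorm {ε : ℝ} (hε : 0 < ε) {u : ℝ → X} {a b : ℝ}
    (hu : AbsolutelyContinuousOnInterval u a b) :
    AbsolutelyContinuousOnInterval (fun s => smoothNorm ε (u s)) a b := by
  rw [absolutelyContinuousOnInterval_iff] at hu ⊢
  intro e he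
  obtain ⟨δ, hδ, h⟩ := hu e he
  refine ⟨δ, hδ, fun I hI hsum => lt_of_le_of_lt (Finset.sum_le_sum fun i _ => ?_) (h I hI hsum)⟩
  rw [Real.dist_eq, dist_eq_norm, abs_sub_le_iff]
  exact ⟨smoothNorm_sub_le hε _ _, norm_sub_rev (u (I.2 i).1) _ ▸ smoothNorm_sub_le hε _ _⟩

theorem norm_le_of_smoothNorm_le {u : ℝ → X} {t B : ℝ}
    (h : ∀ ε > 0, smoothNorm ε (u t) - smoothNorm ε (u 0) ≤ B) : ‖u t‖ ≤ ‖u 0‖ + B := by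
  refine le_of_forall_pos_le_add fun ε hε => ?_
  have := h ε hε
  linarith [norm_le_smoothNorm ε (u t), smoothNorm_le hε.le (u 0)]

variable [InnerProductSpace ℝ X]

theorem hasDerivAt_smoothNorm {ε : ℝ} (hε : 0 < ε) {u : ℝ → X} {u' : X} {t : ℝ}
    (hu : HasDerivAt u u' t) :
    HasDerivAt (fun s => smoothNorm ε (u s)) (inner ℝ (u t) u' / smoothNorm ε (u t)) t := by
  have h := (hu.norm_sq.add_const (ε ^ 2)).sqrt (by positivity)
  convert! h using 1
  rw [smoothNorm, mul_div_mul_left _ _ two_ne_zero]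

/-- If the energy identity holds with a source `f` at the time `t`, the regularized norm grows at
most at the rate `‖f t‖`. -/
theorem exists_hasDerivAt_smoothNorm_le {ε : ℝ} (hε : 0 < ε) {u f : ℝ → X} {T t : ℝ}
    (ht : t ∈ Ioo 0 T)
    (h : ∃ u', HasDerivWithinAt u u' (Icc 0 T) t ∧ inner ℝ u' (u t) ≤ ‖f t‖ * ‖u t‖) :
    ∃ D, HasDerivAt (fun s => smoothNorm ε (u s)) D t ∧ D ≤ ‖f t‖ := by
  obtain ⟨u', hu', hle⟩ := h
  refine ⟨_, hasDerivAt_smoothNorm hε (hu'.hasDerivAt (Icc_mem_nhds ht.1 ht.2)), ?_⟩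
  have hpos : 0 < smoothNorm ε (u t) := Real.sqrt_pos.2 (by positivity)
  rw [div_le_iff₀ hpos, real_inner_comm]
  exact hle.trans (mul_le_mul_of_nonneg_left (norm_le_smoothNorm _ _) (norm_nonneg _))

/-- The energy estimate for a solution that is differentiable at every positive time. -/
theorem norm_le_of_energy_classical {u f : ℝ → X} {T : ℝ}
    (hf : IntervalIntegrable f volume 0 T) (hu : ContinuousOn u (Icc 0 T))
    (h : ∀ t ∈ Ioc 0 T,
      ∃ u', HasDerivWithinAt u u' (Icc 0 T) t ∧ inner ℝ u' (u t) ≤ ‖f t‖ * ‖u t‖)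
    {t : ℝ} (ht : t ∈ Icc 0 T) : ‖u t‖ ≤ ‖u 0‖ + ∫ s in (0 : ℝ)..t, ‖f s‖ := by
  refine norm_le_of_smoothNorm_le fun ε hε => ?_
  have hD : ∀ s ∈ Ioo 0 t, ∃ D, HasDerivAt (fun s => smoothNorm ε (u s)) D s ∧ D ≤ ‖f s‖ :=
    fun s hs => exists_hasDerivAt_smoothNorm_le hε ⟨hs.1, hs.2.trans_le ht.2⟩
      (h s ⟨hs.1, (hs.2.trans_le ht.2).le⟩)
  choose! D hD1 hD2 using hD
  refine intervalIntegral.sub_le_integral_of_hasDeriv_right_of_le ht.1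
    ((continuous_smoothNorm ε).comp_continuousOn (hu.mono (Icc_subset_Icc_right ht.2)))
    (fun s hs => (hD1 s hs).hasDerivWithinAt) ?_ hD2
  rw [← intervalIntegrable_iff_integrableOn_Icc_of_le ht.1]
  exact (hf.mono_set (by
    rw [uIcc_of_le ht.1, uIcc_of_le (ht.1.trans ht.2)]; exact Icc_subset_Icc_right ht.2)).norm

/-- The energy estimate for an absolutely continuous solution of the equations at almost every
time. -/
theorem norm_le_of_energy_ae {u f : ℝ → X} {T : ℝ}
    (hf : IntervalIntegrable f volume 0 T) (hu : AbsolutelyContinuousOnInterval u 0 T)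
    (h : ∀ᵐ t ∂(volume.restrict (Ioc 0 T)),
      ∃ u', HasDerivWithinAt u u' (Icc 0 T) t ∧ inner ℝ u' (u t) ≤ ‖f t‖ * ‖u t‖)
    {t : ℝ} (ht : t ∈ Icc 0 T) : ‖u t‖ ≤ ‖u 0‖ + ∫ s in (0 : ℝ)..t, ‖f s‖ := by
  refine norm_le_of_smoothNorm_le fun ε hε => ?_
  have hsub : uIcc 0 t ⊆ uIcc 0 T := by
    rw [uIcc_of_le ht.1, uIcc_of_le (ht.1.trans ht.2)]; exact Icc_subset_Icc_right ht.2
  have hac := (absolutelyContinuousOnInterval_smoothNorm hε hu).mono hsub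
  rw [← hac.integral_deriv_eq_sub]
  refine intervalIntegral.integral_mono_ae_restrict ht.1 hac.intervalIntegrable_deriv
    (hf.mono_set hsub).norm ?_
  rw [Filter.EventuallyLE, ← restrict_Ioo_eq_restrict_Icc, ae_restrict_iff' measurableSet_Ioo]
  rw [ae_restrict_iff' measurableSet_Ioc] at h
  filter_upwards [h] with s hs hst
  have hsT : s < T := hst.2.trans_le ht.2
  obtain ⟨D, hD, hle⟩ := exists_hasDerivAt_smoothNorm_le hε ⟨hst.1, hsT⟩ (hs ⟨hst.1, hsT.le⟩)
  rwa [hD.deriv]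

end Energy

theorem totalDegree_vecPoly_le {d r : ℕ} {K : Finset (E d)} {v : E d → E d}
    (h : ∃ p, IsVecPolyOn r K v p) (i : Fin d) : (vecPoly r v K i).totalDegree ≤ r := by
  rw [vecPoly, dif_pos h]
  exact h.choose_spec.1 i

/-- Testing the scheme with the solution itself: the pressure drops out, and the remaining form is
nonnegative. -/
theorem Scheme.HoldsAt.energy_le {d : ℕ} {Ω : Set (E d)} {M : Mesh Ω} {S : Scheme M} {T t : ℝ}
    {f u : ℝ → L2Vec Ω} {p : ℝ → L2Scal Ω} (h : S.HoldsAt T f u p t) (hu : u t ∈ S.Vh)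
    (hp : p t ∈ S.Qh) (hN : 0 ≤ S.formN (u t) (u t)) :
    ∃ u', HasDerivWithinAt u u' (Icc 0 T) t ∧ inner ℝ u' (u t) ≤ ‖f t‖ * ‖u t‖ := by
  obtain ⟨⟨u', hu', heq⟩, hb⟩ := h
  refine ⟨u', hu', ?_⟩
  have h1 := heq (u t) hu
  rw [hb (p t) hp] at h1
  linarith [real_inner_le_norm (f t) (u t)]

end UnifiedNS

theorem theorem1 (d : ℕ) (hd : d = 2 ∨ d = 3) (r : ℕ) (σ : ℝ) :
    ∃ η₀ : ℝ, 0 < η₀ ∧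
      ∀ (Ω : Set (UnifiedNS.E d)) (M : UnifiedNS.Mesh Ω) (_ : M.ShapeRegular σ)
        (S : UnifiedNS.Scheme M)
        (_ : 0 < S.ν) (_ : S.r = r)
        (_ : M.IsVelocitySpace S.r S.Vh) (_ : M.IsPressureSpace S.k S.Qh)
        (_ : ∀ F ∈ M.faces, η₀ ≤ S.η F)
        (_ : ∀ F ∈ M.faces, 0 ≤ S.ζ F) (_ : ∀ F, M.IsBoundary F → 1 / 2 ≤ S.ζ F)
        (_ : ∀ v ∈ S.Vh, 0 ≤ S.dh v v)
        (T : ℝ) (_ : 0 < T)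
        (f u : ℝ → UnifiedNS.L2Vec Ω) (p : ℝ → UnifiedNS.L2Scal Ω)
        (_ : IntervalIntegrable f MeasureTheory.volume 0 T)
        (_ : S.IsSolution T f u p),
        ∀ t ∈ Set.Icc 0 T, ‖u t‖ ≤ ‖u 0‖ + ∫ s in (0 : ℝ)..t, ‖f s‖ := by
  open UnifiedNS in
  obtain ⟨C, hC, hC1⟩ := exists_sq_eval_one_le r (d - 1)
  have hd2 : 2 ≤ d := by omega
  have hd3 : d ≤ 3 := by omega
  refine ⟨2 * (d + 1) * ((|σ| + 1) * C), by positivity, ?_⟩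
  intro Ω M hσ S hν hr hV _ hη hζ hζb hdh T _ f u p hf hsol t ht
  obtain ⟨huV, hpQ, hsol⟩ := hsol
  have hN : ∀ s ∈ Set.Icc 0 T, 0 ≤ S.formN (u s) (u s) := by
    intro s hs
    have hc := M.formC_nonneg (by omega) hζ hζb (vecPoly S.r (u s))
    have ha := M.formA_nonneg hd2 hd3 hσ hC hC1 S.κ hη (vecPoly S.r (u s))
      fun K hK i => hr ▸ totalDegree_vecPoly_le (hV _ (huV s hs) K hK) i
    have := mul_nonneg hν.le ha
    have := hdh _ (huV s hs)
    rw [Scheme.formN]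
    linarith
  have henergy : ∀ s ∈ Set.Ioc 0 T, S.HoldsAt T f u p s → _ := fun s hs h =>
    h.energy_le (huV s (Ioc_subset_Icc_self hs)) (hpQ s hs) (hN s (Ioc_subset_Icc_self hs))
  rcases hsol with ⟨hcont, h⟩ | ⟨hac, h⟩
  · exact norm_le_of_energy_classical hf hcont (fun s hs => henergy s hs (h s hs)) ht
  · refine norm_le_of_energy_ae hf hac ?_ ht
    filter_upwards [h, ae_restrict_mem measurableSet_Ioc] with s hs hsI
    exact henergy s hsI hs
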